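/- Let $N,M\in\mathbb{N}_0$, let $f\in C^1(\mathbb{R}^N,\mathbb{R}^N)$, $g\in C^1(\mathbb{R}^N,\mathbb{R}^{N\times M})$, $h\in C^1(\mathbb{R}^N,\mathbb{R})$, and let $R\in\mathbb{R}^{M\times M}$ be symmetric positive definite. Assume $f(0)=0$, $h(0)=0$ and $h(x)>0$ for all $x\ne 0$. For $x\in\mathbb{R}^N$ let $$v^*(x)=\inf_{\mathbf u\in L^\infty([0,\infty);\mathbb{R}^M)}\int_0^\infty \Bigl(h(\mathbf x(t))+\langle \mathbf u(t),R\,\mathbf u(t)\rangle\Bigr)\,dt\in[0,\infty],$$ where $\mathbf x$ is the Carathéodory solution of $\dot{\mathbf x}=f(\mathbf x)+g(\mathbf x)\mathbf u$, $\mathbf x(0)=x$, and the cost is $+\infty$ if $\mathbf x$ blows up in finite time. Let $\Omega\subset\mathbb{R}^N$ be a bounded domain (nonempty, open, connected) containing $0$, and suppose that there are constants $\alpha^*,\beta^*>0$ with $$\alpha^*\|x\|^2\le v^*(x)\le\beta^*\|x\|^2\qquad\text{for all }x\in\Omega .$$ Fix $0<\alpha\le\alpha^*$ and $\beta\ge\beta^*$.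 Let $X_1\subset X_2\subset\cdots$ be finite subsets of $\Omega\setminus\{0\}$ whose union is dense in $\Omega$. Let $k\in C^2(\Omega\times\Omega,\mathbb{R})$ be a positive definite kernel (symmetric, with positive semidefinite Gram matrices) with reproducing kernel Hilbert space $\mathcal H_k(\Omega)$, and suppose that $v^*|_\Omega\in\mathcal H_k(\Omega)$. Let $\mathcal M_{X_n,\alpha,\beta}$ be the set of minimizers of $\|v\|_{\mathcal H_k(\Omega)}$ over all $v\in\mathcal H_k(\Omega)$ such that $v(0)=0$ and, for every $x\in X_n$, $$\langle f(x),\nabla v(x)\rangle-\tfrac14\bigl\langle g(x)^{\top}\nabla v(x),\,R^{-1}g(x)^{\top}\nabla v(x)\bigr\rangle+h(x)=0,\qquad \alpha\|x\|^2\le v(x)\le\beta\|x\|^2 .$$ Then there is a subdomain $\tilde\Omega\subset\Omega$ (nonempty, open, connected) containing $0$ such that for every sequence $(v_n)$ with $v_n\in\mathcal M_{X_n,\alpha,\beta}$ for all $n$, the restrictions of $v_n$ and $v^*$ to $\tilde\Omega$ belong to $\mathcal H_k(\tilde\Omega)$, the reproducing kernel Hilbert space of $k|_{\tilde\Omega\times\tilde\Omega}$,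 and $$\lim_{n\to\infty}\|v_n-v^*\|_{\mathcal H_k(\tilde\Omega)}=0 .$$ -/

import Mathlib

open MeasureTheory Set Filter Topology
open scoped ENNReal Matrix

noncomputable section

namespace OptimalRecovery

/-! ### The infinite-horizon optimal control problem -/

/-- The state space `ℝ^N` with the Euclidean norm. -/
abbrev State (N : ℕ) : Type := EuclideanSpace ℝ (Fin N)

/-- The space of control values `ℝ^M` with the Euclidean norm. -/
abbrev Control (M : ℕ) : Type := EuclideanSpace ℝ (Fin M)

/-- The squared weighted norm `‖w‖_A² = ⟨w, A w⟩`. -/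
def weightedNormSq {d : ℕ} (A : Matrix (Fin d) (Fin d) ℝ) (w : Fin d → ℝ) : ℝ :=
  w ⬝ᵥ (A *ᵥ w)

/-- The standing conditions on the data `f, g, h, R` of the control problem. The map `g` is `C¹`
as a matrix-valued map, that is, entrywise; `Matrix.PosDef` over `ℝ` includes symmetry. -/
structure IsControlData {N M : ℕ} (f : State N → State N)
    (g : State N → Matrix (Fin N) (Fin M) ℝ) (h : State N → ℝ)
    (R : Matrix (Fin M) (Fin M) ℝ) : Prop where
  contDiff_f : ContDiff ℝ 1 f
  contDiff_g : ∀ i j, ContDiff ℝ 1 (fun x => g x i j)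
  contDiff_h : ContDiff ℝ 1 h
  posDef_R : R.PosDef
  f_zero : f 0 = 0
  h_zero : h 0 = 0
  h_pos : ∀ x, x ≠ 0 → 0 < h x

/-- The controlled vector field `f(x) + g(x) u`. -/
def vectorField {N M : ℕ} (f : State N → State N) (g : State N → Matrix (Fin N) (Fin M) ℝ)
    (x : State N) (u : Control M) : State N :=
  f x + WithLp.toLp 2 (g x *ᵥ u.ofLp)

/-- The admissible inputs `L^∞([0,∞); ℝ^M)`. Only the values on `[0,∞)` matter. -/
def admissibleInputs (M : ℕ) : Set (ℝ → Control M) :=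
  {u | MemLp u ∞ (volume.restrict (Ici (0 : ℝ)))}

/-- `y` is a Carathéodory solution on all of `[0,∞)` of `y' = f(y) + g(y) u`, `y(0) = x`
(in integral form). Only the values on `[0,∞)` matter. -/
def IsTrajectory {N M : ℕ} (f : State N → State N) (g : State N → Matrix (Fin N) (Fin M) ℝ)
    (x : State N) (u : ℝ → Control M) (y : ℝ → State N) : Prop :=
  ContinuousOn y (Ici 0) ∧
    ∀ t, 0 ≤ t →
      IntervalIntegrable (fun s => vectorField f g (y s) (u s)) volume 0 t ∧
      y t = x + ∫ s in (0 : ℝ)..t, vectorField f g (y s) (u s)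

/-- The cost `J_∞(x, u) = ∫_0^∞ h(y(t)) + ⟨u(t), R u(t)⟩ dt` along the state trajectory `y` from
`x` under the input `u`. For `C¹` data that trajectory is unique on `[0,∞)` if it exists there, so
the infimum is the cost of this one trajectory; if it blows up in finite time, the infimum is over
the empty family and the cost is `∞`. -/
def cost {N M : ℕ} (f : State N → State N) (g : State N → Matrix (Fin N) (Fin M) ℝ)
    (h : State N → ℝ) (R : Matrix (Fin M) (Fin M) ℝ) (x : State N) (u : ℝ → Control M) : ℝ≥0∞ :=
  ⨅ (y : ℝ → State N) (_ : IsTrajectory f g x u y),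
    ∫⁻ t in Ici (0 : ℝ), ENNReal.ofReal (h (y t) + weightedNormSq R (u t).ofLp)

/-- The optimal value function `v*(x) = inf_u J_∞(x, u)`. -/
def valueFunction {N M : ℕ} (f : State N → State N) (g : State N → Matrix (Fin N) (Fin M) ℝ)
    (h : State N → ℝ) (R : Matrix (Fin M) (Fin M) ℝ) (x : State N) : ℝ≥0∞ :=
  ⨅ u ∈ admissibleInputs M, cost f g h R x u

/-- The left-hand side of the HJB equation for `v` at `x`:
`⟨f(x), ∇v(x)⟩ - 1/4 ‖g(x)ᵀ ∇v(x)‖²_{R⁻¹} + h(x)`. -/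
def hjbResidual {N M : ℕ} (f : State N → State N) (g : State N → Matrix (Fin N) (Fin M) ℝ)
    (h : State N → ℝ) (R : Matrix (Fin M) (Fin M) ℝ) (v : State N → ℝ) (x : State N) : ℝ :=
  inner ℝ (f x) (gradient v x)
    - 1 / 4 * weightedNormSq R⁻¹ ((g x)ᵀ *ᵥ (gradient v x).ofLp) + h x

/-! ### Positive definite kernels and their reproducing kernel Hilbert spaces -/

/-- `k` is a positive definite kernel on `S`: it is symmetric on `S` and all its Gram matrices on
finite sets of points of `S` are positive semidefinite. -/
structure IsPDKernelOn {E : Type} (k : E → E → ℝ) (S : Set E) : Prop where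
  symm : ∀ x ∈ S, ∀ y ∈ S, k x y = k y x
  nonneg : ∀ (T : Finset E), (T : Set E) ⊆ S → ∀ c : E → ℝ,
    0 ≤ ∑ x ∈ T, ∑ y ∈ T, c x * c y * k x y

/-- The kernel `k` on `S` as an (infinite) matrix of continuous linear maps `ℝ → ℝ`. -/
def kernelMatrix {E : Type} (k : E → E → ℝ) (S : Set E) : Matrix S S (ℝ →L[ℝ] ℝ) :=
  Matrix.of fun x y => k x y • ContinuousLinearMap.id ℝ ℝ

theorem IsPDKernelOn.mono {E : Type} {k : E → E → ℝ} {S T : Set E} (hk : IsPDKernelOn k S)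
    (hTS : T ⊆ S) : IsPDKernelOn k T :=
  ⟨fun x hx y hy => hk.symm x (hTS hx) y (hTS hy), fun U hU c => hk.nonneg U (hU.trans hTS) c⟩

theorem IsPDKernelOn.posSemidef {E : Type} {k : E → E → ℝ} {S : Set E} (hk : IsPDKernelOn k S) :
    (kernelMatrix k S).PosSemidef := by
  classical
  have key := (RKHS.posSemidef_tfae (𝕜 := ℝ) (K := kernelMatrix k S)).out 0 2
  refine key.mpr ⟨?_, fun vv => ?_⟩
  · ext x y
    have hid : star (ContinuousLinearMap.id ℝ ℝ) = ContinuousLinearMap.id ℝ ℝ := star_one _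
    simp [kernelMatrix, Matrix.conjTranspose_apply, hk.symm x x.2 y y.2, hid]
  · have h := hk.nonneg (vv.support.map (Function.Embedding.subtype _)) (by simp)
      (Function.extend Subtype.val vv 0)
    simp only [Finset.sum_map, Function.Embedding.subtype_apply,
      Subtype.val_injective.extend_apply] at h
    refine h.trans_eq ?_
    simp only [Finsupp.sum, kernelMatrix, RCLike.re_to_real, Matrix.of_apply]
    refine Finset.sum_congr rfl fun x _ => Finset.sum_congr rfl fun y _ => ?_
    simp [hk.symm x x.2 y y.2]
    ring

/-- The reproducing kernel Hilbert space `H_k(S)` of the positive definite kernel `k` on `S`. -/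
def NativeSpace {E : Type} {k : E → E → ℝ} {S : Set E} (hk : IsPDKernelOn k S) : Type :=
  haveI : Fact (kernelMatrix k S).PosSemidef := ⟨hk.posSemidef⟩
  RKHS.OfKernel (kernelMatrix k S)

instance {E : Type} {k : E → E → ℝ} {S : Set E} (hk : IsPDKernelOn k S) :
    NormedAddCommGroup (NativeSpace hk) :=
  haveI : Fact (kernelMatrix k S).PosSemidef := ⟨hk.posSemidef⟩
  inferInstanceAs (NormedAddCommGroup (RKHS.OfKernel (kernelMatrix k S)))

instance {E : Type} {k : E → E → ℝ} {S : Set E} (hk : IsPDKernelOn k S) :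
    InnerProductSpace ℝ (NativeSpace hk) :=
  haveI : Fact (kernelMatrix k S).PosSemidef := ⟨hk.posSemidef⟩
  inferInstanceAs (InnerProductSpace ℝ (RKHS.OfKernel (kernelMatrix k S)))

instance {E : Type} {k : E → E → ℝ} {S : Set E} (hk : IsPDKernelOn k S) :
    CompleteSpace (NativeSpace hk) :=
  haveI : Fact (kernelMatrix k S).PosSemidef := ⟨hk.posSemidef⟩
  inferInstanceAs (CompleteSpace (RKHS.OfKernel (kernelMatrix k S)))

instance {E : Type} {k : E → E → ℝ} {S : Set E} (hk : IsPDKernelOn k S) :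
    RKHS ℝ (NativeSpace hk) S ℝ :=
  haveI : Fact (kernelMatrix k S).PosSemidef := ⟨hk.posSemidef⟩
  inferInstanceAs (RKHS ℝ (RKHS.OfKernel (kernelMatrix k S)) S ℝ)

/-- The reproducing kernel of `H_k(S)` is `k`. -/
theorem NativeSpace.kernel_eq {E : Type} {k : E → E → ℝ} {S : Set E} (hk : IsPDKernelOn k S) :
    RKHS.kernel (NativeSpace hk) = kernelMatrix k S :=
  haveI : Fact (kernelMatrix k S).PosSemidef := ⟨hk.posSemidef⟩
  RKHS.OfKernel.kernel_ofKernel (K := kernelMatrix k S)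

/-- An element of `H_k(S)`, a function on `S`, as a function on the whole space with value `0` off
`S`. For open `S` its gradient at a point of `S` does not depend on the values off `S`. -/
def NativeSpace.fn {E : Type} {k : E → E → ℝ} {S : Set E} {hk : IsPDKernelOn k S}
    (v : NativeSpace hk) : E → ℝ :=
  Function.extend (Subtype.val : S → E) v 0

/-! ### The collocation problem -/

/-- `v ∈ H_k(Ω)` satisfies the constraints of the collocation problem with centers `X`. -/
structure IsFeasible {N M : ℕ} (f : State N → State N) (g : State N → Matrix (Fin N) (Fin M) ℝ)
    (h : State N → ℝ) (R : Matrix (Fin M) (Fin M) ℝ) (α β : ℝ) (X : Finset (State N))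
    {k : State N → State N → ℝ} {Ω : Set (State N)} {hk : IsPDKernelOn k Ω}
    (v : NativeSpace hk) : Prop where
  hjb : ∀ x ∈ X, hjbResidual f g h R v.fn x = 0
  lower : ∀ x ∈ X, α * ‖x‖ ^ 2 ≤ v.fn x
  upper : ∀ x ∈ X, v.fn x ≤ β * ‖x‖ ^ 2
  zero : v.fn 0 = 0

/-- `v` is a minimizer of the `H_k(Ω)`-norm among all `w ∈ H_k(Ω)` that satisfy the constraints. -/
def IsMinimizer {N M : ℕ} (f : State N → State N) (g : State N → Matrix (Fin N) (Fin M) ℝ)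
    (h : State N → ℝ) (R : Matrix (Fin M) (Fin M) ℝ) (α β : ℝ) (X : Finset (State N))
    {k : State N → State N → ℝ} {Ω : Set (State N)} {hk : IsPDKernelOn k Ω}
    (v : NativeSpace hk) : Prop :=
  IsFeasible f g h R α β X v ∧
    ∀ w : NativeSpace hk, IsFeasible f g h R α β X w → ‖v‖ ≤ ‖w‖

end OptimalRecovery

end

open OptimalRecovery

/-! The value function `v*` competes in every collocation problem. Lying in the native space it is
`C¹`, and at points of differentiability near which it is finite dynamic programming gives the HJB
equation (`IsControlData.hjbResidual_valueFunction`). Hence `‖v_n‖ ≤ ‖v*‖`, and weak limit points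
exist. Since `k` is `C²`, point evaluations and first derivatives at a point are bounded functionals
(`NativeSpace.exists_inner_eq_fderiv`), so a weak limit point `w` satisfies every collocation
condition. By density of the centers and continuity it solves the HJB equation on all of `Ω` with
the same quadratic bounds. In particular `w` is itself a competitor at every stage, so `‖v_n‖ ≤
‖w‖`, which turns weak convergence into norm convergence.

The limit `w` need not be shown equal to `v*` on `Ω`: the two agree on a ball about the origin
(`IsBoundedSolution.exists_forall_eq`). The argument there is a maximum principle. For `θ < 1`,
subtract from `θ v` the solution `w` plus a high power of `w`; at an interior positive maximum the
gradients of `v` and `w` are parallel, and the concavity of the Hamiltonian in the costate together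
with `h > 0` is contradictory. The ball is fixed before any sequence is chosen. Restriction to it is
continuous between native spaces (`NativeSpace.exists_restrict`) and identifies `w` with `v*`, so
the restricted `v_n` converge to the restricted `v*`. -/

/-! ### The native space of a positive definite kernel -/

namespace OptimalRecovery.NativeSpace

/-! ### Kernel sections, evaluation and restriction. -/

section Sections

variable {E : Type} {k : E → E → ℝ} {S : Set E}

/-- The Riesz representer of the evaluation at `x`, that is, the function `k(·, x)`. -/
noncomputable def kernelSection (hk : IsPDKernelOn k S) (x : S) : NativeSpace hk :=
  RKHS.kerFun (NativeSpace hk) x (1 : ℝ)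

theorem fn_apply {hk : IsPDKernelOn k S} (v : NativeSpace hk) (x : S) : v.fn x = v x :=
  Subtype.val_injective.extend_apply _ _ _

theorem inner_kernelSection {hk : IsPDKernelOn k S} (v : NativeSpace hk) (x : S) :
    inner ℝ v (kernelSection hk x) = v.fn x := by
  rw [kernelSection, RKHS.inner_kerFun, fn_apply]
  simp

theorem kernelSection_inner {hk : IsPDKernelOn k S} (v : NativeSpace hk) (x : S) :
    inner ℝ (kernelSection hk x) v = v.fn x := by
  rw [real_inner_comm, inner_kernelSection]

theorem fn_kernelSection (hk : IsPDKernelOn k S) (x y : S) :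
    (kernelSection hk y).fn x = k x y := by
  rw [fn_apply, kernelSection, RKHS.kerFun_apply, kernel_eq]
  simp [kernelMatrix]

theorem fn_of_notMem {hk : IsPDKernelOn k S} (v : NativeSpace hk) {x : E} (hx : x ∉ S) :
    v.fn x = 0 :=
  Function.extend_apply' _ _ _ (by simpa using hx)

theorem fn_add {hk : IsPDKernelOn k S} (v w : NativeSpace hk) : (v + w).fn = v.fn + w.fn := by
  funext x
  by_cases hx : x ∈ S
  · have := fn_apply (v + w) ⟨x, hx⟩
    have h1 := fn_apply v ⟨x, hx⟩
    have h2 := fn_apply w ⟨x, hx⟩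
    simp only at this h1 h2
    rw [Pi.add_apply, this, h1, h2, RKHS.coe_add, Pi.add_apply]
  · simp [fn_of_notMem _ hx]

theorem fn_smul {hk : IsPDKernelOn k S} (c : ℝ) (v : NativeSpace hk) :
    (c • v).fn = c • v.fn := by
  funext x
  by_cases hx : x ∈ S
  · have := fn_apply (c • v) ⟨x, hx⟩
    have h1 := fn_apply v ⟨x, hx⟩
    simp only at this h1
    rw [Pi.smul_apply, this, h1, RKHS.coe_smul, Pi.smul_apply]
  · simp [fn_of_notMem _ hx]

theorem fn_sub {hk : IsPDKernelOn k S} (v w : NativeSpace hk) : (v - w).fn = v.fn - w.fn := by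
  have := fn_add (v - w) w
  rw [sub_add_cancel] at this
  rw [this, add_sub_cancel_right]

theorem fn_zero (hk : IsPDKernelOn k S) : (0 : NativeSpace hk).fn = 0 := by
  simpa using fn_smul 0 (0 : NativeSpace hk)

theorem inner_kernelSection_kernelSection (hk : IsPDKernelOn k S) (x y : S) :
    inner ℝ (kernelSection hk x) (kernelSection hk y) = k x y := by
  rw [kernelSection_inner, fn_kernelSection]

theorem ext_fn {hk : IsPDKernelOn k S} {v w : NativeSpace hk}
    (h : ∀ x ∈ S, v.fn x = w.fn x) : v = w :=
  RKHS.ext fun x => by rw [← fn_apply, ← fn_apply, h x x.2]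

theorem dense_span_kernelSection (hk : IsPDKernelOn k S) :
    Dense (Submodule.span ℝ (range (kernelSection hk)) : Set (NativeSpace hk)) := by
  rw [Submodule.dense_iff_topologicalClosure_eq_top, eq_top_iff,
    ← RKHS.kerFun_dense (NativeSpace hk)]
  refine Submodule.topologicalClosure_mono (Submodule.span_le.2 ?_)
  rintro _ ⟨x, c, rfl⟩
  have : RKHS.kerFun (NativeSpace hk) x c = c • kernelSection hk x := by
    rw [kernelSection, ← map_smul, smul_eq_mul, mul_one]
  rw [this]
  exact Submodule.smul_mem _ _ (Submodule.subset_span (mem_range_self x))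

/-- Restriction to a subset is a contraction between the native spaces. -/
theorem exists_restrict (hk : IsPDKernelOn k S) {T : Set E} (hTS : T ⊆ S) :
    ∃ r : NativeSpace hk →L[ℝ] NativeSpace (hk.mono hTS),
      ∀ v, ∀ x ∈ T, (r v).fn x = v.fn x := by
  let K : T → NativeSpace hk := fun x => kernelSection hk (inclusion hTS x)
  let L := Finsupp.linearCombination ℝ K
  let L' := Finsupp.linearCombination ℝ (kernelSection (hk.mono hTS))
  have hdense : DenseRange L' := by
    have := dense_span_kernelSection (hk.mono hTS)
    rwa [← Finsupp.range_linearCombination] at this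
  -- Both sides are the same Gram form of `k`. The bound makes `L` factor through `L'` even when the
  -- kernel sections are linearly dependent.
  have hnorm : ∀ c, ‖L c‖ ≤ 1 * ‖L' c‖ := by
    intro c
    rw [one_mul]
    apply le_of_eq
    rw [← sq_eq_sq₀ (norm_nonneg _) (norm_nonneg _), ← real_inner_self_eq_norm_sq,
      ← real_inner_self_eq_norm_sq]
    simp only [L, L', Finsupp.linearCombination_apply, Finsupp.inner_sum, Finsupp.sum_inner,
      inner_smul_left, inner_smul_right, K, inner_kernelSection_kernelSection]
  let J := L.extendOfNorm L'
  -- Since `J` sends sections over `T` to sections over `S`, the reproducing property makes its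
  -- adjoint the restriction map.
  refine ⟨ContinuousLinearMap.adjoint J, fun v x hx => ?_⟩
  have hJ : J (kernelSection (hk.mono hTS) ⟨x, hx⟩) = K ⟨x, hx⟩ := by
    have := LinearMap.extendOfNorm_eq hdense ⟨1, hnorm⟩ (Finsupp.single ⟨x, hx⟩ 1)
    simpa [L, L'] using this
  have h1 := inner_kernelSection (ContinuousLinearMap.adjoint J v) ⟨x, hx⟩
  rw [ContinuousLinearMap.adjoint_inner_left, hJ, inner_kernelSection] at h1
  exact h1.symm

end Sections

/-! ### Regularity of functions in the native space. -/

section Smooth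

theorem hasFDerivAt_comp_prodMk_left {E F G : Type*} [NormedAddCommGroup E] [NormedSpace ℝ E]
    [NormedAddCommGroup F] [NormedSpace ℝ F] [NormedAddCommGroup G] [NormedSpace ℝ G]
    {κ : E × F → G} {z : E} {w : F} (h : DifferentiableAt ℝ κ (z, w)) :
    HasFDerivAt (fun z => κ (z, w))
      ((fderiv ℝ κ (z, w)).comp (ContinuousLinearMap.inl ℝ E F)) z :=
  HasFDerivAt.comp (g := κ) z h.hasFDerivAt (hasFDerivAt_prodMk_left z w)

variable {N : ℕ} {k : State N → State N → ℝ} {Ω : Set (State N)}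

/-- The squared distance is a second difference of `k`, namely the increment between `y` and `x` of
`z ↦ k z x - k z y`. The derivative of this function is at most `C * ‖x - y‖`, because the
derivative of the `C²` kernel is locally Lipschitz. So the square is at most `C * ‖x - y‖ ^ 2`,
whence the constant `√C`. -/
theorem exists_norm_kernelSection_sub_le (hk : IsPDKernelOn k Ω) (hΩ : IsOpen Ω)
    (hsm : ContDiffOn ℝ 2 (fun p : State N × State N => k p.1 p.2) (Ω ×ˢ Ω))
    {x₀ : State N} (hx₀ : x₀ ∈ Ω) :
    ∃ r > 0, ∃ C ≥ 0, Metric.ball x₀ r ⊆ Ω ∧ ∀ x y : Ω, (x : State N) ∈ Metric.ball x₀ r →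
      (y : State N) ∈ Metric.ball x₀ r →
        ‖kernelSection hk x - kernelSection hk y‖ ≤ C * ‖(x : State N) - y‖ := by
  set κ : State N × State N → ℝ := fun p => k p.1 p.2 with hκ
  have hopen : IsOpen (Ω ×ˢ Ω) := hΩ.prod hΩ
  have hat : ContDiffAt ℝ 2 κ (x₀, x₀) := hsm.contDiffAt (hopen.mem_nhds ⟨hx₀, hx₀⟩)
  obtain ⟨C, s, hs, hl⟩ := (hat.fderiv_right (m := 1) (by norm_num)).exists_lipschitzOnWith
  obtain ⟨r, hr, hrs⟩ := Metric.mem_nhds_iff.1 (inter_mem hs (hopen.mem_nhds ⟨hx₀, hx₀⟩))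
  rw [← ball_prod_same] at hrs
  have hsub : Metric.ball x₀ r ⊆ Ω := fun x hx => (hrs (mk_mem_prod hx hx)).2.1
  refine ⟨r, hr, √C, Real.sqrt_nonneg _, hsub, fun x y hx hy => ?_⟩
  have hder : ∀ z ∈ Metric.ball x₀ r, HasFDerivWithinAt (fun z => k z x - k z y)
      ((fderiv ℝ κ (z, x) - fderiv ℝ κ (z, y)).comp (ContinuousLinearMap.inl ℝ _ _))
      (Metric.ball x₀ r) z := by
    intro z hz
    have key : ∀ w ∈ Metric.ball x₀ r, HasFDerivAt (fun z => κ (z, w))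
        ((fderiv ℝ κ (z, w)).comp (ContinuousLinearMap.inl ℝ _ _)) z := by
      intro w hw
      have hzw : Ω ×ˢ Ω ∈ 𝓝 (z, w) := hopen.mem_nhds (mk_mem_prod (hsub hz) (hsub hw))
      have hd : ContDiffAt ℝ 2 κ (z, w) := hsm.contDiffAt hzw
      exact hasFDerivAt_comp_prodMk_left (hd.differentiableAt two_ne_zero)
    have := ((key x hx).sub (key y hy)).hasFDerivWithinAt (s := Metric.ball x₀ r)
    rwa [← ContinuousLinearMap.sub_comp] at this
  have hbound : ∀ z ∈ Metric.ball x₀ r,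
      ‖(fderiv ℝ κ (z, x) - fderiv ℝ κ (z, y)).comp (ContinuousLinearMap.inl ℝ _ _)‖
        ≤ C * ‖(x : State N) - y‖ := by
    intro z hz
    calc _ ≤ ‖fderiv ℝ κ (z, x) - fderiv ℝ κ (z, y)‖ * 1 := by
          refine (ContinuousLinearMap.opNorm_comp_le _ _).trans ?_
          gcongr
          exact ContinuousLinearMap.norm_inl_le_one ℝ _ _
      _ ≤ C * ‖((z, (x : State N)) : State N × State N) - (z, (y : State N))‖ := by
          rw [mul_one]
          exact hl.norm_sub_le (hrs (mk_mem_prod hz hx)).1 (hrs (mk_mem_prod hz hy)).1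
      _ = _ := by simp [Prod.norm_def]
  have hmv := (convex_ball x₀ r).norm_image_sub_le_of_norm_hasFDerivWithin_le hder hbound hy hx
  have hsq : ‖kernelSection hk x - kernelSection hk y‖ ^ 2
      = (k x x - k x y) - (k y x - k y y) := by
    rw [← real_inner_self_eq_norm_sq, inner_sub_left, inner_sub_right, inner_sub_right]
    simp only [inner_kernelSection_kernelSection]
  refine (sq_le_sq₀ (norm_nonneg _) (by positivity)).1 ?_
  rw [hsq, mul_pow, Real.sq_sqrt C.coe_nonneg]
  calc _ ≤ _ := le_abs_self _
    _ ≤ C * ‖(x : State N) - y‖ * ‖(x : State N) - y‖ := hmv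
    _ = _ := by ring

variable {hk : IsPDKernelOn k Ω}

theorem norm_fn_sub_le (v : NativeSpace hk) (x y : Ω) :
    ‖v.fn x - v.fn y‖ ≤ ‖v‖ * ‖kernelSection hk x - kernelSection hk y‖ := by
  rw [← inner_kernelSection, ← inner_kernelSection, ← inner_sub_right]
  exact norm_inner_le_norm _ _

/-- The derivative at a point is bounded by the norm, locally uniformly in the point. -/
theorem exists_norm_fderiv_fn_le (hΩ : IsOpen Ω)
    (hsm : ContDiffOn ℝ 2 (fun p : State N × State N => k p.1 p.2) (Ω ×ˢ Ω))
    {x₀ : State N} (hx₀ : x₀ ∈ Ω) :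
    ∃ r > 0, ∃ C ≥ 0, Metric.ball x₀ r ⊆ Ω ∧ ∀ (v : NativeSpace hk), ∀ x ∈ Metric.ball x₀ r,
      ‖fderiv ℝ v.fn x‖ ≤ C * ‖v‖ := by
  obtain ⟨r, hr, C, hC, hsub, hle⟩ := exists_norm_kernelSection_sub_le hk hΩ hsm hx₀
  refine ⟨r, hr, C, hC, hsub, fun v x hx => ?_⟩
  -- A local Lipschitz bound suffices, so the estimate is available before differentiability of
  -- `v.fn` is known.
  refine norm_fderiv_le_of_lip' ℝ (by positivity) ?_
  filter_upwards [Metric.isOpen_ball.mem_nhds hx] with y hy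
  have := hle ⟨y, hsub hy⟩ ⟨x, hsub hx⟩ hy hx
  calc _ ≤ _ := norm_fn_sub_le v ⟨y, hsub hy⟩ ⟨x, hsub hx⟩
    _ ≤ ‖v‖ * (C * ‖y - x‖) := by gcongr
    _ = _ := by ring

theorem contDiffOn_fn_of_mem_span
    (hsm : ContDiffOn ℝ 2 (fun p : State N × State N => k p.1 p.2) (Ω ×ˢ Ω))
    {v : NativeSpace hk} (hv : v ∈ Submodule.span ℝ (range (kernelSection hk))) :
    ContDiffOn ℝ 1 v.fn Ω := by
  induction hv using Submodule.span_induction with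
  | mem v h =>
    obtain ⟨y, rfl⟩ := h
    have h1 : ContDiffOn ℝ 1 (fun x : State N => k x y) Ω :=
      (hsm.of_le (by norm_num)).comp (contDiffOn_id.prodMk contDiffOn_const)
        fun x hx => ⟨hx, y.2⟩
    exact h1.congr fun x hx => fn_kernelSection hk ⟨x, hx⟩ y
  | zero => rw [fn_zero]; exact contDiffOn_const
  | add v w _ _ hv hw => rw [fn_add]; exact hv.add hw
  | smul c v _ hv => rw [fn_smul]; exact contDiffOn_const.smul hv

/-- Finite combinations of kernel sections are `C¹` and dense. The local derivative bound turns norm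
convergence into uniform convergence of derivatives, so the limit is `C¹` as well. -/
theorem contDiffOn_fn (hΩ : IsOpen Ω)
    (hsm : ContDiffOn ℝ 2 (fun p : State N × State N => k p.1 p.2) (Ω ×ˢ Ω))
    (v : NativeSpace hk) : ContDiffOn ℝ 1 v.fn Ω := by
  intro x₀ hx₀
  apply ContDiffAt.contDiffWithinAt
  obtain ⟨r, hr, C, hC, hsub, hle⟩ := exists_norm_fderiv_fn_le (hk := hk) hΩ hsm hx₀
  obtain ⟨u, hu, hlim⟩ := mem_closure_iff_seq_limit.1 (dense_span_kernelSection hk v)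
  have hu1 := fun n => contDiffOn_fn_of_mem_span hsm (hu n)
  have hud : ∀ n, ∀ x ∈ Ω, DifferentiableAt ℝ (u n).fn x := fun n x hx =>
    ((hu1 n).differentiableOn one_ne_zero).differentiableAt (hΩ.mem_nhds hx)
  have hdiff : ∀ n m, ∀ x ∈ Metric.ball x₀ r,
      ‖fderiv ℝ (u n).fn x - fderiv ℝ (u m).fn x‖ ≤ C * ‖u n - u m‖ := by
    intro n m x hx
    rw [← fderiv_sub (hud n x (hsub hx)) (hud m x (hsub hx)), ← fn_sub]
    exact hle _ x hx
  have hcauchy : UniformCauchySeqOn (fun n => fderiv ℝ (u n).fn) atTop (Metric.ball x₀ r) := by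
    rw [Metric.uniformCauchySeqOn_iff]
    intro ε hε
    -- `C` may vanish, hence `C + 1` in the denominator.
    obtain ⟨n₀, hn₀⟩ := Metric.cauchySeq_iff.1 hlim.cauchySeq (ε / (C + 1)) (by positivity)
    refine ⟨n₀, fun m hm n hn x hx => ?_⟩
    have h1 := hn₀ m hm n hn
    rw [dist_eq_norm] at h1 ⊢
    have h2 := hdiff m n x hx
    rw [lt_div_iff₀ (by positivity)] at h1
    nlinarith [norm_nonneg (u m - u n)]
  have hex : ∀ x, ∃ D : State N →L[ℝ] ℝ, x ∈ Metric.ball x₀ r →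
      Tendsto (fun n => fderiv ℝ (u n).fn x) atTop (𝓝 D) := by
    intro x
    by_cases hx : x ∈ Metric.ball x₀ r
    · obtain ⟨D, hD⟩ := cauchySeq_tendsto_of_complete (hcauchy.cauchySeq hx)
      exact ⟨D, fun _ => hD⟩
    · exact ⟨0, fun h => absurd h hx⟩
  choose D hD using hex
  have hunif : TendstoUniformlyOn (fun n => fderiv ℝ (u n).fn) D atTop (Metric.ball x₀ r) :=
    hcauchy.tendstoUniformlyOn_of_tendsto hD
  have hder : ∀ x ∈ Metric.ball x₀ r, HasFDerivAt v.fn (D x) x := by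
    intro x hx
    refine hasFDerivAt_of_tendstoUniformlyOn Metric.isOpen_ball hunif
      (fun n y hy => (hud n y (hsub hy)).hasFDerivAt) (fun y hy => ?_) hx
    have h1 := fun w : NativeSpace hk => inner_kernelSection w ⟨y, hsub hy⟩
    simp only at h1
    simp_rw [← h1]
    exact hlim.inner tendsto_const_nhds
  have hcont : ContinuousOn D (Metric.ball x₀ r) := by
    refine hunif.continuousOn (Eventually.frequently (Eventually.of_forall fun n => ?_))
    exact ((hu1 n).continuousOn_fderiv_of_isOpen hΩ le_rfl).mono hsub
  refine ContDiffOn.contDiffAt (s := Metric.ball x₀ r) ?_ (Metric.ball_mem_nhds x₀ hr)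
  rw [show (1 : WithTop ℕ∞) = 0 + 1 by norm_num,
    contDiffOn_succ_iff_fderiv_of_isOpen Metric.isOpen_ball]
  refine ⟨fun x hx => (hder x hx).differentiableAt.differentiableWithinAt, by simp, ?_⟩
  rw [contDiffOn_zero]
  exact hcont.congr fun x hx => (hder x hx).fderiv

theorem differentiableAt_fn (hΩ : IsOpen Ω)
    (hsm : ContDiffOn ℝ 2 (fun p : State N × State N => k p.1 p.2) (Ω ×ˢ Ω))
    (v : NativeSpace hk) {x : State N} (hx : x ∈ Ω) : DifferentiableAt ℝ v.fn x :=
  ((contDiffOn_fn hΩ hsm v).differentiableOn one_ne_zero).differentiableAt (hΩ.mem_nhds hx)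

/-- Derivatives at a point of `Ω` are represented by elements of the native space. -/
theorem exists_inner_eq_fderiv (hk : IsPDKernelOn k Ω) (hΩ : IsOpen Ω)
    (hsm : ContDiffOn ℝ 2 (fun p : State N × State N => k p.1 p.2) (Ω ×ˢ Ω))
    {x : State N} (hx : x ∈ Ω) (e : State N) :
    ∃ a : NativeSpace hk, ∀ v : NativeSpace hk, inner ℝ a v = fderiv ℝ v.fn x e := by
  obtain ⟨r, hr, C, hC, hsub, hle⟩ := exists_norm_fderiv_fn_le (hk := hk) hΩ hsm hx
  let ℓ : NativeSpace hk →ₗ[ℝ] ℝ :=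
    { toFun := fun v => fderiv ℝ v.fn x e
      map_add' := fun v w => by
        rw [fn_add, fderiv_add (differentiableAt_fn hΩ hsm v hx) (differentiableAt_fn hΩ hsm w hx)]
        rfl
      map_smul' := fun c v => by
        rw [fn_smul, fderiv_const_smul (differentiableAt_fn hΩ hsm v hx)]
        rfl }
  let L := ℓ.mkContinuous (C * ‖e‖) fun v => by
    calc ‖fderiv ℝ v.fn x e‖ ≤ ‖fderiv ℝ v.fn x‖ * ‖e‖ := ContinuousLinearMap.le_opNorm _ _
      _ ≤ C * ‖v‖ * ‖e‖ := by gcongr; exact hle v x (Metric.mem_ball_self hr)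
      _ = _ := by ring
  exact ⟨(InnerProductSpace.toDual ℝ _).symm L, fun v => by
    rw [InnerProductSpace.toDual_symm_apply]; rfl⟩

end Smooth

end OptimalRecovery.NativeSpace

/-! ### The Hamiltonian -/

namespace OptimalRecovery

/-! ### Weighted quadratic forms. -/

section Quadratic

variable {d : ℕ} {A : Matrix (Fin d) (Fin d) ℝ}

theorem weightedNormSq_nonneg (hA : A.PosSemidef) (w : Fin d → ℝ) : 0 ≤ weightedNormSq A w := by
  simpa [weightedNormSq] using hA.dotProduct_mulVec_nonneg w

theorem weightedNormSq_smul (c : ℝ) (w : Fin d → ℝ) :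
    weightedNormSq A (c • w) = c ^ 2 * weightedNormSq A w := by
  simp only [weightedNormSq, Matrix.mulVec_smul, smul_dotProduct, dotProduct_smul, smul_eq_mul]
  ring

/-- Completing the square; symmetry of `A` merges the two cross terms. -/
theorem weightedNormSq_add_inv_mulVec (hA : A.PosDef) (u b : Fin d → ℝ) :
    weightedNormSq A (u + (1 / 2 : ℝ) • (A⁻¹ *ᵥ b)) =
      weightedNormSq A u + b ⬝ᵥ u + 1 / 4 * weightedNormSq A⁻¹ b := by
  have hdet : IsUnit A.det := (Matrix.isUnit_iff_isUnit_det A).1 hA.isUnit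
  have h1 : A *ᵥ (A⁻¹ *ᵥ b) = b := by
    rw [Matrix.mulVec_mulVec, Matrix.mul_nonsing_inv _ hdet, Matrix.one_mulVec]
  have hsymm : Aᵀ = A := by simpa using hA.isHermitian.eq
  have h2 : (A⁻¹ *ᵥ b) ⬝ᵥ (A *ᵥ u) = b ⬝ᵥ u := by
    rw [Matrix.dotProduct_mulVec, ← Matrix.mulVec_transpose, hsymm, h1]
  simp only [weightedNormSq, Matrix.mulVec_add, Matrix.mulVec_smul, h1, add_dotProduct,
    dotProduct_add, smul_dotProduct, dotProduct_smul, h2, smul_eq_mul,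
    dotProduct_comm u b, dotProduct_comm (A⁻¹ *ᵥ b) b]
  ring

end Quadratic

section Hamiltonian

variable {N M : ℕ} {f : State N → State N} {g : State N → Matrix (Fin N) (Fin M) ℝ}
  {h : State N → ℝ} {R : Matrix (Fin M) (Fin M) ℝ}

/-- The minimum over `u` of `⟨p, f(x) + g(x) u⟩ + h(x) + ⟨u, R u⟩`. -/
noncomputable def hamiltonian (f : State N → State N) (g : State N → Matrix (Fin N) (Fin M) ℝ)
    (h : State N → ℝ) (R : Matrix (Fin M) (Fin M) ℝ) (x p : State N) : ℝ :=
  inner ℝ (f x) p - 1 / 4 * weightedNormSq R⁻¹ ((g x)ᵀ *ᵥ p.ofLp) + h x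

theorem hjbResidual_eq_hamiltonian (v : State N → ℝ) (x : State N) :
    hjbResidual f g h R v x = hamiltonian f g h R x (gradient v x) := rfl

/-- The square completed in `u`: the defect is a nonnegative form that vanishes exactly at the
optimal feedback `-(1/2) R⁻¹ gᵀ p`. It yields both the lower bound and its attainment. -/
theorem hamiltonian_add_weightedNormSq (hR : R.PosDef) (x p : State N) (u : Control M) :
    hamiltonian f g h R x p
        + weightedNormSq R (u.ofLp + (1 / 2 : ℝ) • (R⁻¹ *ᵥ ((g x)ᵀ *ᵥ p.ofLp)))
      = inner ℝ p (vectorField f g x u) + h x + weightedNormSq R u.ofLp := by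
  have hi : inner ℝ p (vectorField f g x u)
      = inner ℝ (f x) p + ((g x)ᵀ *ᵥ p.ofLp) ⬝ᵥ u.ofLp := by
    rw [vectorField, inner_add_right, real_inner_comm]
    congr 1
    rw [EuclideanSpace.inner_eq_star_dotProduct, Matrix.mulVec_transpose,
      ← Matrix.dotProduct_mulVec, star_trivial, dotProduct_comm]
  rw [weightedNormSq_add_inv_mulVec hR, hi, hamiltonian]
  ring

theorem hamiltonian_le (hR : R.PosDef) (x p : State N) (u : Control M) :
    hamiltonian f g h R x p
      ≤ inner ℝ p (vectorField f g x u) + h x + weightedNormSq R u.ofLp := by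
  rw [← hamiltonian_add_weightedNormSq hR]
  exact le_add_of_nonneg_right (weightedNormSq_nonneg hR.posSemidef _)

theorem exists_hamiltonian_eq (hR : R.PosDef) (x p : State N) :
    ∃ u : Control M, hamiltonian f g h R x p
      = inner ℝ p (vectorField f g x u) + h x + weightedNormSq R u.ofLp := by
  refine ⟨WithLp.toLp 2 (-((1 / 2 : ℝ) • (R⁻¹ *ᵥ ((g x)ᵀ *ᵥ p.ofLp)))), ?_⟩
  rw [← hamiltonian_add_weightedNormSq hR]
  simp [weightedNormSq]

theorem hamiltonian_smul (c : ℝ) (x p : State N) :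
    hamiltonian f g h R x (c • p) = c * inner ℝ (f x) p
      - c ^ 2 * (1 / 4 * weightedNormSq R⁻¹ ((g x)ᵀ *ᵥ p.ofLp)) + h x := by
  rw [hamiltonian, inner_smul_right, WithLp.ofLp_smul, Matrix.mulVec_smul, weightedNormSq_smul]
  ring

theorem IsControlData.continuous_g (hd : IsControlData f g h R) : Continuous g :=
  continuous_matrix fun i j => (hd.contDiff_g i j).continuous

theorem IsControlData.continuous_hamiltonian (hd : IsControlData f g h R) :
    Continuous fun q : State N × State N => hamiltonian f g h R q.1 q.2 := by
  have hf := hd.contDiff_f.continuous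
  have hh := hd.contDiff_h.continuous
  have hg := hd.continuous_g
  have hb : Continuous fun q : State N × State N => (g q.1)ᵀ *ᵥ q.2.ofLp :=
    (hg.comp continuous_fst).matrix_transpose.matrix_mulVec
      ((PiLp.continuous_ofLp 2 _).comp continuous_snd)
  unfold hamiltonian weightedNormSq
  exact (((hf.comp continuous_fst).inner continuous_snd).sub
    (continuous_const.mul (hb.dotProduct (continuous_const.matrix_mulVec hb)))).add
    (hh.comp continuous_fst)

/-- Scaling a zero of the Hamiltonian down makes it positive. -/
theorem IsControlData.hamiltonian_smul_pos (hd : IsControlData f g h R) {x p : State N}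
    (hx : x ≠ 0) (hp : hamiltonian f g h R x p = 0) {θ : ℝ} (h0 : 0 ≤ θ) (h1 : θ < 1) :
    0 < hamiltonian f g h R x (θ • p) := by
  have hQ := weightedNormSq_nonneg hd.posDef_R.inv.posSemidef ((g x)ᵀ *ᵥ p.ofLp)
  have hh := hd.h_pos x hx
  rw [hamiltonian_smul]
  rw [hamiltonian] at hp
  -- With `Q` the quadratic term at `p`, eliminating the inner product by `hp` leaves `θ (1 - θ) Q +
  -- (1 - θ) h x`.
  nlinarith [mul_nonneg (mul_nonneg h0 (sub_pos.2 h1).le) hQ, mul_pos (sub_pos.2 h1) hh]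

/-- Scaling a zero of the Hamiltonian up makes it nonpositive. -/
theorem IsControlData.hamiltonian_smul_nonpos (hd : IsControlData f g h R) {x p : State N}
    (hx : x ≠ 0) (hp : hamiltonian f g h R x p = 0) {c : ℝ} (hc : 1 ≤ c) :
    hamiltonian f g h R x (c • p) ≤ 0 := by
  have hQ := weightedNormSq_nonneg hd.posDef_R.inv.posSemidef ((g x)ᵀ *ᵥ p.ofLp)
  have hh := hd.h_pos x hx
  rw [hamiltonian_smul]
  rw [hamiltonian] at hp
  -- The same elimination leaves `-(c (c - 1) Q + (c - 1) h x)`.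
  nlinarith [mul_nonneg (mul_nonneg (zero_le_one.trans hc) (sub_nonneg.2 hc)) hQ,
    mul_nonneg (sub_nonneg.2 hc) hh.le]

end Hamiltonian

/-! ### Comparison of classical solutions of the HJB equation -/

section Comparison

variable {N M : ℕ} {f : State N → State N} {g : State N → Matrix (Fin N) (Fin M) ℝ}
  {h : State N → ℝ} {R : Matrix (Fin M) (Fin M) ℝ}

/-- `v` is a classical solution of the HJB equation on `Ω` with quadratic bounds. -/
structure IsBoundedSolution (f : State N → State N) (g : State N → Matrix (Fin N) (Fin M) ℝ)
    (h : State N → ℝ) (R : Matrix (Fin M) (Fin M) ℝ) (α β : ℝ) (Ω : Set (State N))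
    (v : State N → ℝ) : Prop where
  differentiableAt : ∀ x ∈ Ω, DifferentiableAt ℝ v x
  hjb : ∀ x ∈ Ω, hjbResidual f g h R v x = 0
  lower : ∀ x ∈ Ω, α * ‖x‖ ^ 2 ≤ v x
  upper : ∀ x ∈ Ω, v x ≤ β * ‖x‖ ^ 2

variable {α β r : ℝ} {Ω : Set (State N)} {v w : State N → ℝ}

theorem IsBoundedSolution.apply_zero (hv : IsBoundedSolution f g h R α β Ω v)
    (h0 : (0 : State N) ∈ Ω) : v 0 = 0 :=
  le_antisymm (by simpa using hv.upper 0 h0) (by simpa using hv.lower 0 h0)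

/-- Maximum principle for `φ` on the closed ball. On the sphere `w ≥ α r²`, so the penalty is at
least `β r²` and dominates `θ v`; at the origin `φ` vanishes. A positive maximum is therefore
interior and away from zero. The penalty is a function of `w`, so criticality reads `θ ∇v = l ∇w`
with `l ≥ 1`; the Hamiltonian is positive at the left side and nonpositive at the right. -/
theorem IsBoundedSolution.mul_le_add_pow (hd : IsControlData f g h R) (hα : 0 < α) (hβ : 0 < β)
    (hr : 0 < r) (hsub : Metric.closedBall 0 r ⊆ Ω)
    (hv : IsBoundedSolution f g h R α β Ω v) (hw : IsBoundedSolution f g h R α β Ω w)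
    {θ : ℝ} (h0 : 0 ≤ θ) (h1 : θ < 1) (m : ℕ) {x : State N} (hx : x ∈ Metric.closedBall 0 r) :
    θ * v x ≤ w x + β * r ^ 2 * (w x / (α * r ^ 2)) ^ (m + 1) := by
  set c := α * r ^ 2 with hc
  have hc0 : 0 < c := by positivity
  set B := β * r ^ 2 with hB
  have hB0 : 0 < B := by positivity
  have hzero : (0 : State N) ∈ Ω := hsub (Metric.mem_closedBall_self hr.le)
  have hw0 : ∀ x ∈ Ω, 0 ≤ w x := fun x hx => le_trans (by positivity) (hw.lower x hx)
  set φ : State N → ℝ := fun x => θ * v x - (w x + B * (w x / c) ^ (m + 1)) with hφ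
  have hder : ∀ y ∈ Ω, HasFDerivAt φ (θ • fderiv ℝ v y -
      (1 + B * ((m + 1) * (w y / c) ^ m * c⁻¹)) • fderiv ℝ w y) y := by
    intro y hy
    have hvd := (hv.differentiableAt y hy).hasFDerivAt
    have hwd := (hw.differentiableAt y hy).hasFDerivAt
    have hp := (((hwd.mul_const c⁻¹).pow (m + 1)).const_mul B)
    refine ((hvd.const_mul θ).sub (hwd.add hp)).congr_fderiv ?_
    ext e
    simp only [FunLike.coe_sub, FunLike.coe_add, FunLike.coe_smul, Pi.sub_apply, Pi.add_apply,
      Pi.smul_apply, smul_eq_mul, nsmul_eq_mul, Nat.add_sub_cancel, div_eq_mul_inv]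
    push_cast
    ring
  have hcont : ContinuousOn φ (Metric.closedBall 0 r) := fun y hy =>
    (hder y (hsub hy)).continuousAt.continuousWithinAt
  obtain ⟨z, hz, hmax⟩ := (isCompact_closedBall (0 : State N) r).exists_isMaxOn
    ⟨0, Metric.mem_closedBall_self hr.le⟩ hcont
  suffices hz0 : φ z ≤ 0 by
    have : φ x ≤ φ z := hmax hx
    simp only [hφ] at this hz0
    linarith
  by_contra! hpos
  have hzne : z ≠ 0 := by
    rintro rfl
    simp [hφ, hv.apply_zero hzero, hw.apply_zero hzero] at hpos
  have hzr : ‖z‖ < r := by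
    by_contra! hge
    have hzeq : ‖z‖ = r := le_antisymm (by simpa using hz) hge
    have hvz := hv.upper z (hsub hz)
    have hwz := hw.lower z (hsub hz)
    rw [hzeq, ← hB] at hvz
    rw [hzeq, ← hc] at hwz
    have hpow : 1 ≤ (w z / c) ^ (m + 1) := one_le_pow₀ ((one_le_div hc0).2 hwz)
    have h2 : θ * v z ≤ 1 * B := by
      rcases le_total 0 (v z) with hp | hn
      · exact mul_le_mul h1.le hvz hp zero_le_one
      · exact (mul_nonpos_of_nonneg_of_nonpos h0 hn).trans (by linarith)
    have h3 : B * 1 ≤ B * (w z / c) ^ (m + 1) := by gcongr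
    simp only [hφ] at hpos
    linarith
  have hloc : IsLocalMax φ z := by
    filter_upwards [Metric.isOpen_ball.mem_nhds (show z ∈ Metric.ball 0 r by simpa using hzr)]
      with y hy using hmax (Metric.ball_subset_closedBall hy)
  have hcrit := hloc.hasFDerivAt_eq_zero (hder z (hsub hz))
  set l := 1 + B * ((m + 1) * (w z / c) ^ m * c⁻¹)
  have hl : 1 ≤ l := by
    have := hw0 z (hsub hz)
    exact le_add_of_nonneg_right (by positivity)
  have hgrad : θ • gradient v z = l • gradient w z := by
    refine ext_inner_right ℝ fun e => ?_
    rw [inner_smul_left, inner_smul_left, inner_gradient_left, inner_gradient_left]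
    have := DFunLike.congr_fun hcrit e
    simpa [sub_eq_zero] using this
  have h2 := hd.hamiltonian_smul_pos hzne (hv.hjb z (hsub hz)) h0 h1
  have h3 := hd.hamiltonian_smul_nonpos hzne (hw.hjb z (hsub hz)) hl
  rw [hgrad] at h2
  exact h2.not_ge h3

/-- The condition on `x` forces `w x < α r²`, so the penalty tends to zero as `m → ∞`; then `θ → 1`.
-/
theorem IsBoundedSolution.le (hd : IsControlData f g h R) (hα : 0 < α) (hβ : 0 < β)
    (hr : 0 < r) (hsub : Metric.closedBall 0 r ⊆ Ω)
    (hv : IsBoundedSolution f g h R α β Ω v) (hw : IsBoundedSolution f g h R α β Ω w)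
    {x : State N} (hx : x ∈ Metric.closedBall 0 r) (hxβ : β * ‖x‖ ^ 2 < α * r ^ 2) :
    v x ≤ w x := by
  have hc0 : 0 < α * r ^ 2 := by positivity
  have hw0 : 0 ≤ w x := le_trans (by positivity) (hw.lower x (hsub hx))
  have hlt : w x / (α * r ^ 2) < 1 := (div_lt_one hc0).2 ((hw.upper x (hsub hx)).trans_lt hxβ)
  have hlim : Tendsto (fun m : ℕ => w x + β * r ^ 2 * (w x / (α * r ^ 2)) ^ (m + 1)) atTop
      (𝓝 (w x + β * r ^ 2 * 0)) :=
    tendsto_const_nhds.add (tendsto_const_nhds.mul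
      ((tendsto_pow_atTop_nhds_zero_of_lt_one (by positivity) hlt).comp (tendsto_add_atTop_nat 1)))
  rw [mul_zero, add_zero] at hlim
  have hθ : ∀ θ ∈ Ico (0 : ℝ) 1, θ * v x ≤ w x := fun θ hθ =>
    ge_of_tendsto' hlim fun m => mul_le_add_pow hd hα hβ hr hsub hv hw hθ.1 hθ.2 m hx
  have hlim2 : Tendsto (fun θ : ℝ => θ * v x) (𝓝[<] 1) (𝓝 (1 * v x)) :=
    ((continuous_id.mul continuous_const).tendsto 1).mono_left nhdsWithin_le_nhds
  rw [one_mul] at hlim2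
  refine le_of_tendsto hlim2 ?_
  filter_upwards [Ico_mem_nhdsLT (zero_lt_one' ℝ)] with θ h using hθ θ h

/-- The neighbourhood of the origin on which bounded solutions coincide depends only on the bounds
and on the domain. -/
theorem IsBoundedSolution.exists_forall_eq (hd : IsControlData f g h R) (hα : 0 < α) (hβ : 0 < β)
    (hΩ : IsOpen Ω) (h0 : (0 : State N) ∈ Ω) :
    ∃ ρ > 0, Metric.ball 0 ρ ⊆ Ω ∧ ∀ v w : State N → ℝ, IsBoundedSolution f g h R α β Ω v →
      IsBoundedSolution f g h R α β Ω w → ∀ x ∈ Metric.ball 0 ρ, v x = w x := by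
  obtain ⟨r, hr, hsub⟩ := Metric.nhds_basis_closedBall.mem_iff.1 (hΩ.mem_nhds h0)
  have hs : 0 < √(α * r ^ 2 / β) := Real.sqrt_pos.2 (by positivity)
  -- Within this radius the upper bound `β ‖x‖²` stays below the lower bound `α r²` on the sphere of
  -- radius `r`.
  refine ⟨min r √(α * r ^ 2 / β), lt_min hr hs, ?_, fun v w hv hw x hx => ?_⟩
  · exact ((Metric.ball_subset_ball (min_le_left _ _)).trans Metric.ball_subset_closedBall).trans
      hsub
  · rw [mem_ball_zero_iff, lt_min_iff] at hx
    have hxr : x ∈ Metric.closedBall 0 r := by simpa using hx.1.le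
    have hxβ : β * ‖x‖ ^ 2 < α * r ^ 2 := by
      rw [mul_comm, ← lt_div_iff₀ hβ]
      exact (Real.lt_sqrt (norm_nonneg x)).1 hx.2
    exact le_antisymm (hv.le hd hα hβ hr hsub hw hxr hxβ) (hw.le hd hα hβ hr hsub hv hxr hxβ)

end Comparison

end OptimalRecovery

/-! ### Dynamic programming -/

namespace OptimalRecovery

variable {N M : ℕ} {f : State N → State N} {g : State N → Matrix (Fin N) (Fin M) ℝ}
  {h : State N → ℝ} {R : Matrix (Fin M) (Fin M) ℝ}

/-- The running cost along a trajectory. -/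
noncomputable def runningCost (h : State N → ℝ) (R : Matrix (Fin M) (Fin M) ℝ)
    (u : ℝ → Control M) (y : ℝ → State N) (s : Set ℝ) : ℝ≥0∞ :=
  ∫⁻ t in s, ENNReal.ofReal (h (y t) + weightedNormSq R (u t).ofLp)

theorem valueFunction_le_runningCost {x : State N} {u : ℝ → Control M} {y : ℝ → State N}
    (hu : u ∈ admissibleInputs M) (hy : IsTrajectory f g x u y) :
    valueFunction f g h R x ≤ runningCost h R u y (Ici 0) :=
  (iInf₂_le u hu).trans (iInf₂_le y hy)

theorem le_valueFunction {x : State N} {a : ℝ≥0∞}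
    (ha : ∀ u ∈ admissibleInputs M, ∀ y, IsTrajectory f g x u y →
      a ≤ runningCost h R u y (Ici 0)) :
    a ≤ valueFunction f g h R x :=
  le_iInf₂ fun u hu => le_iInf₂ fun y hy => ha u hu y hy

theorem runningCost_split (u : ℝ → Control M) (y : ℝ → State N) {t : ℝ} (ht : 0 ≤ t) :
    runningCost h R u y (Ici 0) = runningCost h R u y (Icc 0 t) + runningCost h R u y (Ioi t) := by
  rw [← Icc_union_Ioi_eq_Ici ht, runningCost,
    lintegral_union measurableSet_Ioi (disjoint_left.2 fun s hs hs' => hs.2.not_gt hs')]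
  rfl

theorem runningCost_Ioi_zero (u : ℝ → Control M) (y : ℝ → State N) :
    runningCost h R u y (Ioi 0) = runningCost h R u y (Ici 0) :=
  setLIntegral_congr Ioi_ae_eq_Ici

theorem runningCost_comp_add (u : ℝ → Control M) (y : ℝ → State N) (t : ℝ) :
    runningCost h R (fun s => u (s + t)) (fun s => y (s + t)) (Ioi 0)
      = runningCost h R u y (Ioi t) := by
  -- Translation is a measurable embedding, so no measurability of the integrand is needed.
  have := (measurePreserving_add_right volume t).setLIntegral_comp_preimage_emb
    (measurableEmbedding_addRight t)
    (fun s => ENNReal.ofReal (h (y s) + weightedNormSq R (u s).ofLp)) (Ioi t)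
  simpa [runningCost] using this

theorem runningCost_congr {u u' : ℝ → Control M} {y y' : ℝ → State N} {s : Set ℝ}
    (hs : MeasurableSet s) (hu : EqOn u u' s) (hy : EqOn y y' s) :
    runningCost h R u y s = runningCost h R u' y' s :=
  setLIntegral_congr_fun hs fun t ht => by simp only [hu ht, hy ht]

theorem admissibleInputs_comp_add {u : ℝ → Control M} (hu : u ∈ admissibleInputs M) {t : ℝ}
    (ht : 0 ≤ t) : (fun s => u (s + t)) ∈ admissibleInputs M := by
  have hmp := (measurePreserving_add_right volume t).restrict_preimage (measurableSet_Ici (a := t))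
  have hpre : (fun s : ℝ => s + t) ⁻¹' Ici t = Ici 0 := by ext; simp
  rw [hpre] at hmp
  have hu' : MemLp u ∞ (volume.restrict (Ici t)) :=
    MemLp.mono_measure (Measure.restrict_mono (Ici_subset_Ici.2 ht) le_rfl) hu
  exact hu'.comp_measurePreserving hmp

theorem IsTrajectory.comp_add {x : State N} {u : ℝ → Control M} {y : ℝ → State N}
    (hy : IsTrajectory f g x u y) {t : ℝ} (ht : 0 ≤ t) :
    IsTrajectory f g (y t) (fun s => u (s + t)) (fun s => y (s + t)) := by
  refine ⟨hy.1.comp (by fun_prop) fun s hs => add_nonneg hs ht, fun s hs => ?_⟩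
  have h1 := hy.2 t ht
  have h2 := hy.2 (s + t) (add_nonneg hs ht)
  have h3 := h1.1.symm.trans h2.1
  refine ⟨by simpa using h3.comp_add_right t, ?_⟩
  rw [intervalIntegral.integral_comp_add_right (fun r => vectorField f g (y r) (u r)) t, zero_add]
  change y (s + t) = _
  rw [h2.2, ← intervalIntegral.integral_add_adjacent_intervals h1.1 h3, ← add_assoc, ← h1.2]

/-- The cost over an initial time interval plus the optimal cost from the state reached is at most
the total cost. -/
theorem IsTrajectory.add_valueFunction_le {x : State N} {u : ℝ → Control M} {y : ℝ → State N}
    (hy : IsTrajectory f g x u y) (hu : u ∈ admissibleInputs M) {t : ℝ} (ht : 0 ≤ t) :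
    runningCost h R u y (Icc 0 t) + valueFunction f g h R (y t)
      ≤ runningCost h R u y (Ici 0) := by
  rw [runningCost_split u y ht, ← runningCost_comp_add u y t, runningCost_Ioi_zero]
  gcongr
  exact valueFunction_le_runningCost (admissibleInputs_comp_add hu ht) (hy.comp_add ht)

/-! ### Concatenation of inputs and trajectories. -/

section Concat

/-- Switch from `a` to `b` after time `t`. -/
noncomputable def switchAt {E : Type*} (t : ℝ) (a b : ℝ → E) : ℝ → E :=
  fun s => if s ≤ t then a s else b (s - t)

theorem switchAt_of_le {E : Type*} {t s : ℝ} {a b : ℝ → E} (hs : s ≤ t) :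
    switchAt t a b s = a s := if_pos hs

theorem switchAt_of_lt {E : Type*} {t s : ℝ} {a b : ℝ → E} (hs : t < s) :
    switchAt t a b s = b (s - t) := if_neg hs.not_ge

theorem switchAt_add {E : Type*} {t s : ℝ} {a b : ℝ → E} (hs : 0 < s) :
    switchAt t a b (s + t) = b s := by
  rw [switchAt_of_lt (by linarith), add_sub_cancel_right]

theorem switchAt_mem_admissibleInputs (t : ℝ) {u u' : ℝ → Control M}
    (hu : u ∈ admissibleInputs M) (hu' : u' ∈ admissibleInputs M) :
    switchAt t u u' ∈ admissibleInputs M := by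
  have hmp := (measurePreserving_sub_right volume t).restrict_preimage (measurableSet_Ici (a := 0))
  have hpre : (fun s : ℝ => s - t) ⁻¹' Ici 0 = Ici t := by ext; simp
  rw [hpre] at hmp
  have h1 : MemLp (fun s => u' (s - t)) ∞ (volume.restrict (Ici t)) :=
    MemLp.comp_measurePreserving hu' hmp
  have h2 : MemLp ((Iic t).piecewise u fun s => u' (s - t)) ∞ (volume.restrict (Ici 0)) := by
    refine MemLp.piecewise measurableSet_Iic ?_ ?_
    · exact MemLp.mono_measure Measure.restrict_le_self hu
    · rw [Measure.restrict_restrict measurableSet_Iic.compl]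
      exact h1.mono_measure (Measure.restrict_mono (fun s hs => by
        have := hs.1
        simp only [mem_compl_iff, mem_Iic, not_le] at this
        exact this.le) le_rfl)
  have heq : switchAt t u u' = (Iic t).piecewise u fun s => u' (s - t) := by
    funext s
    simp [switchAt, piecewise]
  rw [heq]
  exact h2

/-- Trajectories on a finite time interval. -/
def IsTrajectoryOn (f : State N → State N) (g : State N → Matrix (Fin N) (Fin M) ℝ)
    (x : State N) (T : ℝ) (u : ℝ → Control M) (y : ℝ → State N) : Prop :=
  ContinuousOn y (Icc 0 T) ∧
    ∀ t ∈ Icc 0 T,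
      IntervalIntegrable (fun s => vectorField f g (y s) (u s)) volume 0 t ∧
      y t = x + ∫ s in (0 : ℝ)..t, vectorField f g (y s) (u s)

theorem IsTrajectory.apply_zero {x : State N} {u : ℝ → Control M} {y : ℝ → State N}
    (hy : IsTrajectory f g x u y) : y 0 = x := by
  simpa using (hy.2 0 le_rfl).2

theorem IsTrajectoryOn.switchAt {x : State N} {T : ℝ} (hT : 0 ≤ T) {u u' : ℝ → Control M}
    {y y' : ℝ → State N} (hy : IsTrajectoryOn f g x T u y)
    (hy' : IsTrajectory f g (y T) u' y') :
    IsTrajectory f g x (switchAt T u u') (switchAt T y y') := by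
  have hint : ∀ t ∈ Icc 0 T, EqOn (fun s => vectorField f g (y s) (u s))
      (fun s => vectorField f g (OptimalRecovery.switchAt T y y' s)
        (OptimalRecovery.switchAt T u u' s)) (uIoc 0 t) := by
    intro t ht s hs
    rw [uIoc_of_le ht.1] at hs
    simp only [switchAt_of_le (hs.2.trans ht.2)]
  have hfst : ∀ t ∈ Icc 0 T,
      IntervalIntegrable (fun s => vectorField f g (OptimalRecovery.switchAt T y y' s)
        (OptimalRecovery.switchAt T u u' s)) volume 0 t ∧
      y t = x + ∫ s in (0 : ℝ)..t, vectorField f g (OptimalRecovery.switchAt T y y' s)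
        (OptimalRecovery.switchAt T u u' s) := by
    intro t ht
    obtain ⟨h1, h2⟩ := hy.2 t ht
    refine ⟨h1.congr (hint t ht), ?_⟩
    rw [h2]
    congr 1
    exact intervalIntegral.integral_congr_ae (Eventually.of_forall fun s hs => hint t ht hs)
  constructor
  · rw [← Icc_union_Ici_eq_Ici hT]
    refine ContinuousOn.union_of_isClosed (hy.1.congr fun s hs => switchAt_of_le hs.2) ?_
      isClosed_Icc isClosed_Ici
    refine ContinuousOn.congr (f := fun s => y' (s - T))
      (hy'.1.comp (by fun_prop) fun s hs => mem_Ici.2 (sub_nonneg.2 hs)) fun s hs => ?_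
    -- At the switching time the first branch is active; it matches the second because `y'` starts
    -- at `y T`.
    rcases (mem_Ici.1 hs).eq_or_lt with rfl | hlt
    · simp [switchAt_of_le, hy'.apply_zero]
    · exact switchAt_of_lt hlt
  · intro t ht
    rcases le_or_gt t T with htT | htT
    · rw [switchAt_of_le htT]
      exact hfst t ⟨ht, htT⟩
    obtain ⟨h1, h2⟩ := hfst T ⟨hT, le_rfl⟩
    obtain ⟨h3, h4⟩ := hy'.2 (t - T) (sub_nonneg.2 htT.le)
    have h5 := h3.comp_sub_right T
    rw [zero_add, sub_add_cancel] at h5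
    have heq : EqOn (fun s => vectorField f g (y' (s - T)) (u' (s - T)))
        (fun s => vectorField f g (OptimalRecovery.switchAt T y y' s)
          (OptimalRecovery.switchAt T u u' s)) (uIoc T t) := by
      intro s hs
      rw [uIoc_of_le htT.le] at hs
      simp only [switchAt_of_lt hs.1]
    have h6 := h5.congr heq
    refine ⟨h1.trans h6, ?_⟩
    rw [switchAt_of_lt htT, h4, h2, ← intervalIntegral.integral_add_adjacent_intervals h1 h6,
      add_assoc]
    congr 2
    rw [← intervalIntegral.integral_congr_ae (Eventually.of_forall fun s hs => heq hs),
      intervalIntegral.integral_comp_sub_right (fun s => vectorField f g (y' s) (u' s)), sub_self]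

/-- The optimal cost is at most the cost over an initial time interval plus the optimal cost from
the state reached. -/
theorem IsTrajectoryOn.valueFunction_le {x : State N} {T : ℝ} (hT : 0 ≤ T) {u : ℝ → Control M}
    {y : ℝ → State N} (hy : IsTrajectoryOn f g x T u y) (hu : u ∈ admissibleInputs M) :
    valueFunction f g h R x
      ≤ runningCost h R u y (Icc 0 T) + valueFunction f g h R (y T) := by
  -- Moving the initial cost to the left leaves a lower bound for the value at `y T`, to be tested
  -- on each continuation. Truncated subtraction keeps this valid for infinite costs.
  rw [← tsub_le_iff_left]
  refine le_valueFunction fun u' hu' y' hy' => tsub_le_iff_left.2 ?_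
  refine (valueFunction_le_runningCost (switchAt_mem_admissibleInputs T hu hu')
    (hy.switchAt hT hy')).trans_eq ?_
  rw [runningCost_split _ _ hT, ← runningCost_comp_add _ _ T, ← runningCost_Ioi_zero u' y',
    runningCost_congr measurableSet_Icc (fun s hs => switchAt_of_le hs.2)
      (fun s hs => switchAt_of_le hs.2),
    runningCost_congr measurableSet_Ioi (fun s hs => switchAt_add hs) (fun s hs => switchAt_add hs)]

end Concat

end OptimalRecovery

/-! ### The value function solves the HJB equation -/

namespace OptimalRecovery

variable {N M : ℕ} {f : State N → State N} {g : State N → Matrix (Fin N) (Fin M) ℝ}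
  {h : State N → ℝ} {R : Matrix (Fin M) (Fin M) ℝ}

theorem IsControlData.contDiff_vectorField (hd : IsControlData f g h R) (u : Control M) :
    ContDiff ℝ 1 fun x => vectorField f g x u := by
  refine hd.contDiff_f.add ?_
  refine (PiLp.contDiff_toLp (p := 2)).comp (contDiff_pi.2 fun i => ?_)
  simp only [Matrix.mulVec, dotProduct]
  exact ContDiff.sum fun j _ => (hd.contDiff_g i j).mul contDiff_const

theorem IsControlData.h_nonneg (hd : IsControlData f g h R) (x : State N) : 0 ≤ h x := by
  rcases eq_or_ne x 0 with rfl | hx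
  · exact hd.h_zero.ge
  · exact (hd.h_pos x hx).le

theorem hasDerivAt_nonneg_of_eventually_le {φ : ℝ → ℝ} {φ' a : ℝ} (hφ : HasDerivAt φ φ' a)
    (hle : ∀ᶠ t in 𝓝[>] a, φ a ≤ φ t) : 0 ≤ φ' := by
  have hlim : Tendsto (slope φ a) (𝓝[>] a) (𝓝 φ') := (hasDerivAt_iff_tendsto_slope.1 hφ).mono_left
    (nhdsWithin_mono a fun t (ht : a < t) => ht.ne')
  refine ge_of_tendsto hlim ?_
  filter_upwards [hle, self_mem_nhdsWithin] with t ht hat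
  rw [slope_def_field]
  exact div_nonneg (sub_nonneg.2 ht) (sub_nonneg.2 (le_of_lt hat))

/-- Only the negative part is discarded, so `φ` may change sign, as the lower bound for the running
cost in the supersolution argument can. -/
theorem ofReal_integral_le_lintegral {α : Type*} [MeasurableSpace α] {μ : Measure α} {φ : α → ℝ}
    (hφ : Integrable φ μ) :
    ENNReal.ofReal (∫ t, φ t ∂μ) ≤ ∫⁻ t, ENNReal.ofReal (φ t) ∂μ := by
  refine ENNReal.ofReal_le_of_le_toReal ?_
  rw [integral_eq_lintegral_pos_part_sub_lintegral_neg_part hφ]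
  exact sub_le_self _ ENNReal.toReal_nonneg

/-! ### The inequality obtained from constant inputs. -/

section Subsolution

/-- Integral curves of the vector field for a constant input are trajectories. -/
theorem IsControlData.isTrajectoryOn_const (hd : IsControlData f g h R) {u : Control M}
    {y : ℝ → State N} {T ε : ℝ} (hε : 0 < ε) (hT : T < ε)
    (hy : ∀ t ∈ Ioo (-ε) ε, HasDerivAt y (vectorField f g (y t) u) t) :
    IsTrajectoryOn f g (y 0) T (fun _ => u) y := by
  have hcont : ContinuousOn y (Ioo (-ε) ε) := fun t ht =>
    (hy t ht).continuousAt.continuousWithinAt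
  have hsub : Icc 0 T ⊆ Ioo (-ε) ε := fun t ht => ⟨by linarith [ht.1], ht.2.trans_lt hT⟩
  refine ⟨hcont.mono hsub, fun t ht => ?_⟩
  have hsub' : uIcc 0 t ⊆ Ioo (-ε) ε := by
    rw [uIcc_of_le ht.1]
    exact (Icc_subset_Icc_right ht.2).trans hsub
  have hint : IntervalIntegrable (fun s => vectorField f g (y s) u) volume 0 t :=
    ((hd.contDiff_vectorField u).continuous.comp_continuousOn
      (hcont.mono hsub')).intervalIntegrable
  refine ⟨hint, ?_⟩
  rw [intervalIntegral.integral_eq_sub_of_hasDerivAt (fun s hs => hy s (hsub' hs)) hint]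
  abel

/-- Apply the constant input `u` for a short time and continue almost optimally. By dynamic
programming, cost so far plus value at the current state is never below its initial value, so its
derivative at time zero is nonnegative. -/
theorem IsControlData.inner_gradient_valueFunction_nonneg (hd : IsControlData f g h R)
    {x : State N} (hfin : ∀ᶠ z in 𝓝 x, valueFunction f g h R z ≠ ∞)
    (hdiff : DifferentiableAt ℝ (fun z => (valueFunction f g h R z).toReal) x) (u : Control M) :
    0 ≤ inner ℝ (gradient (fun z => (valueFunction f g h R z).toReal) x) (vectorField f g x u)
      + h x + weightedNormSq R u.ofLp := by
  set V : State N → ℝ := fun z => (valueFunction f g h R z).toReal with hV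
  obtain ⟨y, hy0, ε, hε, hy⟩ :=
    (hd.contDiff_vectorField u).contDiffAt
      |>.exists_forall_mem_closedBall_exists_eq_forall_mem_Ioo_hasDerivAt₀ (x₀ := x) 0
  simp only [zero_sub, zero_add] at hy
  have hmem : (0 : ℝ) ∈ Ioo (-ε) ε := ⟨by linarith, hε⟩
  have hycont : ContinuousOn y (Ioo (-ε) ε) := fun t ht =>
    (hy t ht).continuousAt.continuousWithinAt
  set L : ℝ → ℝ := fun t => h (y t) + weightedNormSq R u.ofLp with hL
  have hLcont : ContinuousOn L (Ioo (-ε) ε) :=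
    (hd.contDiff_h.continuous.comp_continuousOn hycont).add continuousOn_const
  have hLnn : ∀ t, 0 ≤ L t := fun t =>
    add_nonneg (hd.h_nonneg _) (weightedNormSq_nonneg hd.posDef_R.posSemidef _)
  have hder : HasDerivAt (fun t => (∫ s in (0 : ℝ)..t, L s) + V (y t))
      (L 0 + inner ℝ (gradient V x) (vectorField f g x u)) 0 := by
    refine HasDerivAt.add ?_ ?_
    · exact intervalIntegral.integral_hasDerivAt_right (by simp)
        (hLcont.stronglyMeasurableAtFilter isOpen_Ioo 0 hmem)
        (hLcont.continuousAt (isOpen_Ioo.mem_nhds hmem))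
    · have h1 := hy 0 hmem
      rw [hy0] at h1
      rw [inner_gradient_left]
      have h2 : HasFDerivAt V (fderiv ℝ V x) (y 0) := by
        rw [hy0]
        exact hdiff.hasFDerivAt
      exact h2.comp_hasDerivAt 0 h1
  have hnn := hasDerivAt_nonneg_of_eventually_le hder ?_
  · simp only [hL, hy0] at hnn
    linarith
  have hy0' : Tendsto y (𝓝 0) (𝓝 x) := by
    have := (hy 0 hmem).continuousAt.tendsto
    rwa [hy0] at this
  filter_upwards [nhdsWithin_le_nhds (hy0'.eventually hfin), Ioo_mem_nhdsGT hε] with t hfint ht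
  have htraj := hd.isTrajectoryOn_const hε ht.2 hy
  rw [hy0] at htraj
  have hle := htraj.valueFunction_le (h := h) (R := R) ht.1.le (memLp_top_const u)
  have hint : IntegrableOn L (Icc 0 t) :=
    (hLcont.mono fun s hs => ⟨by linarith [hs.1], hs.2.trans_lt ht.2⟩).integrableOn_Icc
  have hcost : runningCost h R (fun _ => u) y (Icc 0 t)
      = ENNReal.ofReal (∫ s in (0 : ℝ)..t, L s) := by
    rw [intervalIntegral.integral_of_le ht.1.le, ← integral_Icc_eq_integral_Ioc,
      ofReal_integral_eq_lintegral_ofReal hint (Eventually.of_forall hLnn)]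
    rfl
  rw [hcost] at hle
  have h3 := ENNReal.toReal_mono (ENNReal.add_ne_top.2 ⟨ENNReal.ofReal_ne_top, hfint⟩) hle
  rw [ENNReal.toReal_add ENNReal.ofReal_ne_top hfint,
    ENNReal.toReal_ofReal (intervalIntegral.integral_nonneg ht.1.le fun s _ => hLnn s)] at h3
  simpa [hV, hy0] using h3

end Subsolution

/-! ### The inequality valid for all inputs. -/

section Supersolution

/-- Where the Hamiltonian is positive, the running cost dominates the decrease of the linearization
with a margin that is uniform in the input. -/
theorem IsControlData.eventually_le_of_hamiltonian_pos (hd : IsControlData f g h R)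
    {x p : State N} (hpos : 0 < hamiltonian f g h R x p) :
    ∃ ε > 0, ∃ η > 0, ∀ᶠ z in 𝓝 x, ∀ u : Control M,
      η - inner ℝ p (vectorField f g z u) + 2 * ε * ‖vectorField f g z u‖
        ≤ h z + weightedNormSq R u.ofLp := by
  have hev := hd.continuous_hamiltonian.continuousAt.eventually
    (lt_mem_nhds (show hamiltonian f g h R x p / 2 < hamiltonian f g h R (x, p).1 (x, p).2 by
      simp only; linarith))
  obtain ⟨δ, hδ, hball⟩ := Metric.eventually_nhds_iff_ball.1 hev
  rw [← ball_prod_same] at hball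
  refine ⟨δ / 4, by positivity, hamiltonian f g h R x p / 2, half_pos hpos, ?_⟩
  filter_upwards [Metric.ball_mem_nhds x hδ] with z hz u
  set F := vectorField f g z u with hF
  -- Tilting `p` against the velocity by at most `δ / 2` keeps the Hamiltonian above half its value
  -- and gains `(δ / 2) * ‖F‖`, however large `u` is. For `F = 0` the convention `0⁻¹ = 0` gives `q
  -- = p`.
  set q : State N := p - (2 * (δ / 4) * ‖F‖⁻¹) • F with hq
  have hqp : q ∈ Metric.ball p δ := by
    rw [mem_ball_iff_norm, hq, sub_sub_cancel_left, norm_neg, norm_smul, Real.norm_eq_abs,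
      abs_of_nonneg (by positivity), mul_assoc]
    have : ‖F‖⁻¹ * ‖F‖ ≤ 1 := inv_mul_le_one
    nlinarith
  have h1 := hball (z, q) (mk_mem_prod hz hqp)
  have h2 := hamiltonian_le (f := f) (g := g) (h := h) hd.posDef_R z q u
  have h3 : inner ℝ q F = inner ℝ p F - 2 * (δ / 4) * ‖F‖ := by
    rw [hq, inner_sub_left, real_inner_smul_left, real_inner_self_eq_norm_sq]
    rcases eq_or_ne ‖F‖ 0 with h0 | h0
    · simp [h0]
    · field_simp
  rw [← hF, h3] at h2
  simp only at h1
  linarith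

theorem exists_first_exit {E : Type*} [NormedAddCommGroup E] {y : ℝ → E} {x : E} {ρ : ℝ}
    (hρ : 0 < ρ) (hy : ContinuousOn y (Icc 0 1)) (h0 : y 0 = x) :
    ∃ t ∈ Icc (0 : ℝ) 1, (∀ s ∈ Icc 0 t, ‖y s - x‖ ≤ ρ) ∧ (t = 1 ∨ ‖y t - x‖ = ρ) := by
  set φ : ℝ → ℝ := fun s => ‖y s - x‖ with hφ
  have hcont : ContinuousOn φ (Icc 0 1) := (hy.sub continuousOn_const).norm
  by_cases hex : ∃ s ∈ Icc (0 : ℝ) 1, ρ ≤ φ s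
  · have hcomp : IsCompact (Icc (0 : ℝ) 1 ∩ φ ⁻¹' Ici ρ) :=
      isCompact_Icc.of_isClosed_subset (hcont.preimage_isClosed_of_isClosed isClosed_Icc isClosed_Ici)
        inter_subset_left
    obtain ⟨t, ⟨ht, htρ⟩, hmin⟩ := hcomp.exists_isLeast (hex.imp fun s hs => ⟨hs.1, hs.2⟩)
    have hlt : ∀ s ∈ Icc 0 t, ρ ≤ φ s → s = t := fun s hs hle =>
      le_antisymm hs.2 (hmin ⟨⟨hs.1, hs.2.trans ht.2⟩, hle⟩)
    have heq : φ t = ρ := by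
      obtain ⟨s, hs, hsρ⟩ := intermediate_value_Icc ht.1
        (hcont.mono (Icc_subset_Icc_right ht.2)) (show ρ ∈ Icc (φ 0) (φ t) from
          ⟨by simp [hφ, h0, hρ.le], htρ⟩)
      rw [← hlt s hs hsρ.ge]
      exact hsρ
    refine ⟨t, ht, fun s hs => ?_, Or.inr heq⟩
    by_contra! hgt
    have := hlt s hs hgt.le
    rw [this] at hgt
    exact hgt.ne' heq
  · push Not at hex
    exact ⟨1, by simp, fun s hs => (hex s hs).le, Or.inl rfl⟩

/-- Inputs have no common bound, so no short time confines all trajectories near `x`. Each one is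
instead stopped at time 1 or on first reaching distance `ρ`. If the Hamiltonian were positive, every
input would cost at least `V x + gap`, contradicting the definition of the infimum. -/
theorem IsControlData.hamiltonian_gradient_valueFunction_nonpos (hd : IsControlData f g h R)
    {x : State N} (hfin : ∀ᶠ z in 𝓝 x, valueFunction f g h R z ≠ ∞)
    (hdiff : DifferentiableAt ℝ (fun z => (valueFunction f g h R z).toReal) x) :
    hamiltonian f g h R x (gradient (fun z => (valueFunction f g h R z).toReal) x) ≤ 0 := by
  by_contra! hpos
  set V : State N → ℝ := fun z => (valueFunction f g h R z).toReal with hV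
  set p := gradient V x with hp
  obtain ⟨ε, hε, η, hη, hev⟩ := hd.eventually_le_of_hamiltonian_pos hpos
  have hlin : ∀ᶠ z in 𝓝 x, V x + inner ℝ p (z - x) - ε * ‖z - x‖ ≤ V z := by
    have hbound := hdiff.hasFDerivAt.isLittleO.def hε
    filter_upwards [hbound] with z hz
    rw [hp, inner_gradient_left]
    have := (abs_le.1 hz).1
    linarith
  obtain ⟨ρ, hρ, hball⟩ := Metric.nhds_basis_closedBall.mem_iff.1 (hev.and (hlin.and hfin))
  -- The rate `η` pays when time 1 is reached, `ε * ρ` when the ball is left. Of the margin `2 * ε`,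
  -- one half absorbs the linearization error of `V` and the other supplies `ε * ρ`.
  set gap := min η (ε * ρ) with hgap
  have hgap0 : 0 < gap := lt_min hη (by positivity)
  have hxfin : valueFunction f g h R x ≠ ∞ := hfin.self_of_nhds
  have hkey : ENNReal.ofReal (V x + gap) ≤ valueFunction f g h R x := by
    refine le_valueFunction fun u hu y hy => ?_
    obtain ⟨t, ht, hin, hexit⟩ := exists_first_exit hρ
      (hy.1.mono Icc_subset_Ici_self) hy.apply_zero
    have hmem : ∀ s ∈ Icc 0 t, y s ∈ Metric.closedBall x ρ := fun s hs =>
      mem_closedBall_iff_norm.2 (hin s hs)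
    obtain ⟨-, hlint, hfint⟩ := hball (hmem t ⟨ht.1, le_rfl⟩)
    obtain ⟨hint, heq⟩ := hy.2 t ht.1
    set F : ℝ → State N := fun s => vectorField f g (y s) (u s) with hF
    have hΔ : y t - x = ∫ s in (0 : ℝ)..t, F s := by rw [heq, add_sub_cancel_left]
    set ψ : ℝ → ℝ := fun s => η - inner ℝ p (F s) + 2 * ε * ‖F s‖ with hψ
    have hi1 : IntervalIntegrable (fun s => inner ℝ p (F s)) volume 0 t :=
      ⟨(innerSL ℝ p).integrable_comp hint.1, (innerSL ℝ p).integrable_comp hint.2⟩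
    have hi2 : IntervalIntegrable (fun s => 2 * ε * ‖F s‖) volume 0 t :=
      hint.norm.const_mul _
    have hi0 : IntervalIntegrable (fun _ : ℝ => η) volume 0 t := intervalIntegrable_const
    have hψint : IntervalIntegrable ψ volume 0 t := (hi0.sub hi1).add hi2
    have hψval : η * t - inner ℝ p (y t - x) + 2 * ε * ‖y t - x‖ ≤ ∫ s in (0 : ℝ)..t, ψ s := by
      have h1 : ∫ s in (0 : ℝ)..t, inner ℝ p (F s) = inner ℝ p (y t - x) := by
        rw [hΔ]
        exact (innerSL ℝ p).intervalIntegral_comp_comm hint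
      have h2 : ‖y t - x‖ ≤ ∫ s in (0 : ℝ)..t, ‖F s‖ := by
        rw [hΔ]
        exact intervalIntegral.norm_integral_le_integral_norm ht.1
      rw [intervalIntegral.integral_add (hi0.sub hi1) hi2, intervalIntegral.integral_sub hi0 hi1,
        h1, intervalIntegral.integral_const, intervalIntegral.integral_const_mul, sub_zero,
        smul_eq_mul, mul_comm t η]
      gcongr
    have hcost : ENNReal.ofReal (∫ s in (0 : ℝ)..t, ψ s) ≤ runningCost h R u y (Icc 0 t) := by
      rw [intervalIntegral.integral_of_le ht.1, ← integral_Icc_eq_integral_Ioc]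
      refine (ofReal_integral_le_lintegral ?_).trans ?_
      · exact (intervalIntegrable_iff_integrableOn_Icc_of_le ht.1).1 hψint
      · exact setLIntegral_mono' measurableSet_Icc fun s hs =>
          ENNReal.ofReal_le_ofReal ((hball (hmem s hs)).1 (u s))
    have hgap_le : gap ≤ η * t + ε * ‖y t - x‖ := by
      rcases hexit with rfl | hexit
      · have : 0 ≤ ε * ‖y 1 - x‖ := by positivity
        exact (min_le_left _ _).trans (by linarith)
      · rw [hexit]
        have : 0 ≤ η * t := mul_nonneg hη.le ht.1
        exact (min_le_right _ _).trans (by linarith)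
    calc ENNReal.ofReal (V x + gap)
        ≤ ENNReal.ofReal ((∫ s in (0 : ℝ)..t, ψ s) + V (y t)) :=
          ENNReal.ofReal_le_ofReal (by linarith)
      _ ≤ ENNReal.ofReal (∫ s in (0 : ℝ)..t, ψ s) + ENNReal.ofReal (V (y t)) :=
          ENNReal.ofReal_add_le
      _ ≤ runningCost h R u y (Icc 0 t) + valueFunction f g h R (y t) := by
          rw [hV, ENNReal.ofReal_toReal hfint]
          gcongr
      _ ≤ _ := hy.add_valueFunction_le hu ht.1
  have := (ENNReal.ofReal_le_iff_le_toReal hxfin).1 hkey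
  simp only [hV] at this
  linarith

end Supersolution

/-- The optimal value function solves the HJB equation at every point of differentiability near
which it is finite. -/
theorem IsControlData.hjbResidual_valueFunction (hd : IsControlData f g h R)
    {x : State N} (hfin : ∀ᶠ z in 𝓝 x, valueFunction f g h R z ≠ ∞)
    (hdiff : DifferentiableAt ℝ (fun z => (valueFunction f g h R z).toReal) x) :
    hjbResidual f g h R (fun z => (valueFunction f g h R z).toReal) x = 0 := by
  refine le_antisymm (hd.hamiltonian_gradient_valueFunction_nonpos hfin hdiff) ?_
  obtain ⟨u, hu⟩ := exists_hamiltonian_eq (f := f) (g := g) (h := h) hd.posDef_R x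
    (gradient (fun z => (valueFunction f g h R z).toReal) x)
  rw [hjbResidual_eq_hamiltonian, hu]
  exact hd.inner_gradient_valueFunction_nonneg hfin hdiff u

end OptimalRecovery

/-! ### Convergence of the collocation solutions -/

namespace OptimalRecovery

/-! ### Weak limits in Hilbert space. -/

section WeakLimit

variable {H ι : Type*} [NormedAddCommGroup H] [InnerProductSpace ℝ H]

/-- Bounded real families converge along an ultrafilter, so all inner products have limits at once,
without extracting subsequences. The limits form a bounded functional, represented by Riesz. -/
theorem exists_weak_limit_of_bounded [CompleteSpace H] (U : Ultrafilter ι) {v : ι → H} {C : ℝ}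
    (hv : ∀ n, ‖v n‖ ≤ C) :
    ∃ w : H, ∀ a : H, Tendsto (fun n => inner ℝ a (v n)) U (𝓝 (inner ℝ a w)) := by
  have hbound : ∀ a n, ‖inner ℝ a (v n)‖ ≤ C * ‖a‖ := fun a n =>
    (norm_inner_le_norm _ _).trans (by rw [mul_comm]; gcongr; exact hv n)
  have hex : ∀ a : H, ∃ l ∈ Metric.closedBall (0 : ℝ) (C * ‖a‖),
      Tendsto (fun n => inner ℝ a (v n)) U (𝓝 l) := fun a =>
    (isCompact_closedBall (0 : ℝ) (C * ‖a‖)).ultrafilter_le_nhds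
      (U.map fun n => inner ℝ a (v n)) (by
        rw [Ultrafilter.coe_map, le_principal_iff, mem_map]
        exact univ_mem' fun n => by simpa using hbound a n)
  choose ℓ hℓ hlim using hex
  let L : H →ₗ[ℝ] ℝ :=
    { toFun := ℓ
      map_add' := fun a b => tendsto_nhds_unique (hlim (a + b))
        (by simpa only [inner_add_left] using (hlim a).add (hlim b))
      map_smul' := fun c a => tendsto_nhds_unique (hlim (c • a))
        (by
          simp only [real_inner_smul_left]
          exact (hlim a).const_mul c) }
  refine ⟨(InnerProductSpace.toDual ℝ H).symm (L.mkContinuous C fun a => ?_), fun a => ?_⟩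
  · exact mem_closedBall_zero_iff.1 (hℓ a)
  · rw [real_inner_comm, InnerProductSpace.toDual_symm_apply]
    exact hlim a

/-- Expanding, `‖v n - w‖ ^ 2` is at most `2 * ‖w‖ ^ 2 - 2 * inner ℝ w (v n)`, which tends to zero.
-/
theorem tendsto_of_weak_limit_of_norm_le {l : Filter ι} {v : ι → H} {w : H}
    (hweak : ∀ a : H, Tendsto (fun n => inner ℝ a (v n)) l (𝓝 (inner ℝ a w)))
    (hle : ∀ n, ‖v n‖ ≤ ‖w‖) : Tendsto v l (𝓝 w) := by
  rw [tendsto_iff_norm_sub_tendsto_zero]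
  have hsq : Tendsto (fun n => 2 * ‖w‖ ^ 2 - 2 * inner ℝ w (v n)) l (𝓝 0) := by
    have := ((hweak w).const_mul 2).const_sub (2 * ‖w‖ ^ 2)
    rwa [real_inner_self_eq_norm_sq, sub_self] at this
  have hsq' : Tendsto (fun n => ‖v n - w‖ ^ 2) l (𝓝 0) := by
    refine squeeze_zero (fun n => by positivity) (fun n => ?_) hsq
    rw [norm_sub_sq_real, real_inner_comm]
    have := pow_le_pow_left₀ (norm_nonneg _) (hle n) 2
    linarith
  have hsqrt := (Real.continuous_sqrt.tendsto 0).comp hsq'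
  rw [Real.sqrt_zero] at hsqrt
  exact hsqrt.congr fun n => Real.sqrt_sq (norm_nonneg _)

end WeakLimit

variable {N M : ℕ} {f : State N → State N} {g : State N → Matrix (Fin N) (Fin M) ℝ}
  {h : State N → ℝ} {R : Matrix (Fin M) (Fin M) ℝ} {α β : ℝ}
  {k : State N → State N → ℝ} {Ω : Set (State N)} {hk : IsPDKernelOn k Ω}

theorem _root_.Filter.EventuallyEq.hjbResidual_eq {v w : State N → ℝ} {x : State N}
    (hvw : v =ᶠ[𝓝 x] w) : hjbResidual f g h R v x = hjbResidual f g h R w x := by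
  simp only [hjbResidual, gradient, hvw.fderiv_eq]

section WeakConvergence

variable {ι : Type*} {l : Filter ι} {v : ι → NativeSpace hk} {w : NativeSpace hk}

theorem NativeSpace.tendsto_fn
    (hweak : ∀ a, Tendsto (fun n => inner ℝ a (v n)) l (𝓝 (inner ℝ a w)))
    {x : State N} (hx : x ∈ Ω) : Tendsto (fun n => (v n).fn x) l (𝓝 (w.fn x)) := by
  have := hweak (kernelSection hk ⟨x, hx⟩)
  simpa only [kernelSection_inner] using this

theorem NativeSpace.tendsto_gradient_fn (hΩ : IsOpen Ω)
    (hsm : ContDiffOn ℝ 2 (fun p : State N × State N => k p.1 p.2) (Ω ×ˢ Ω))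
    (hweak : ∀ a, Tendsto (fun n => inner ℝ a (v n)) l (𝓝 (inner ℝ a w)))
    {x : State N} (hx : x ∈ Ω) :
    Tendsto (fun n => gradient (v n).fn x) l (𝓝 (gradient w.fn x)) := by
  have hcoord : ∀ (u : State N → ℝ) (i : Fin N),
      gradient u x i = fderiv ℝ u x (EuclideanSpace.single i 1) := fun u i => by
    rw [← inner_gradient_left, EuclideanSpace.inner_single_right]
    simp
  have hpi : Tendsto (fun n => (gradient (v n).fn x).ofLp) l (𝓝 (gradient w.fn x).ofLp) := by
    refine tendsto_pi_nhds.2 fun i => ?_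
    obtain ⟨a, ha⟩ := exists_inner_eq_fderiv hk hΩ hsm hx (EuclideanSpace.single i 1)
    simpa only [hcoord, ha] using hweak a
  exact ((PiLp.continuous_toLp 2 _).tendsto _).comp hpi

end WeakConvergence

theorem NativeSpace.continuousOn_hjbResidual (hd : IsControlData f g h R) (hΩ : IsOpen Ω)
    (hsm : ContDiffOn ℝ 2 (fun p : State N × State N => k p.1 p.2) (Ω ×ˢ Ω))
    (v : NativeSpace hk) : ContinuousOn (hjbResidual f g h R v.fn) Ω := by
  have hfd : ContinuousOn (fderiv ℝ v.fn) Ω :=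
    (contDiffOn_fn hΩ hsm v).continuousOn_fderiv_of_isOpen hΩ le_rfl
  have hgrad : ContinuousOn (gradient v.fn) Ω := by
    refine ((InnerProductSpace.toDual ℝ (State N)).symm.continuous.comp_continuousOn hfd).congr
      fun x _ => ?_
    rw [Function.comp_apply, gradient]
  have hpair : ContinuousOn (fun x => (x, gradient v.fn x)) Ω := continuousOn_id.prodMk hgrad
  have hcomp := hd.continuous_hamiltonian.comp_continuousOn hpair
  exact hcomp.congr fun x _ => hjbResidual_eq_hamiltonian v.fn x

/-- A function in the native space that satisfies all collocation conditions is a classical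
solution on the whole domain. -/
theorem NativeSpace.isBoundedSolution_of_isFeasible (hd : IsControlData f g h R) (hΩ : IsOpen Ω)
    (hsm : ContDiffOn ℝ 2 (fun p : State N × State N => k p.1 p.2) (Ω ×ˢ Ω))
    {X : ℕ → Finset (State N)} (hX_sub : ∀ n, (X n : Set (State N)) ⊆ Ω)
    (hX_dense : Ω ⊆ closure (⋃ n, (X n : Set (State N))))
    {v : NativeSpace hk} (hv : ∀ n, IsFeasible f g h R α β (X n) v) :
    IsBoundedSolution f g h R α β Ω v.fn := by
  have hsub : (⋃ n, (X n : Set (State N))) ⊆ Ω := iUnion_subset hX_sub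
  have hcont : ContinuousOn v.fn Ω := (contDiffOn_fn hΩ hsm v).continuousOn
  -- Nonstrict inequalities pass from the dense centers to `Ω`; the equation is treated as two of
  -- them.
  have hext : ∀ φ : State N → ℝ, ContinuousOn φ Ω → (∀ n, ∀ x ∈ X n, 0 ≤ φ x) →
      ∀ x ∈ Ω, 0 ≤ φ x := by
    intro φ hφ hpos x hx
    refine ContinuousWithinAt.closure_le (f := fun _ => (0 : ℝ)) (hX_dense hx)
      continuousWithinAt_const ((hφ x hx).mono hsub) fun y hy => ?_
    obtain ⟨n, hn⟩ := mem_iUnion.1 hy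
    exact hpos n y hn
  have hres := continuousOn_hjbResidual hd hΩ hsm v
  have hsq : ∀ c : ℝ, ContinuousOn (fun x : State N => c * ‖x‖ ^ 2) Ω := fun c => by fun_prop
  refine ⟨fun x hx => differentiableAt_fn hΩ hsm v hx, fun x hx => ?_, fun x hx => ?_,
    fun x hx => ?_⟩
  · refine le_antisymm ?_ (hext _ hres (fun n y hy => ((hv n).hjb y hy).ge) x hx)
    exact neg_nonneg.1 (hext _ hres.neg
      (fun n y hy => neg_nonneg.2 ((hv n).hjb y hy).le) x hx)
  · exact sub_nonneg.1 (hext _ (hcont.sub (hsq α))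
      (fun n y hy => sub_nonneg.2 ((hv n).lower y hy)) x hx)
  · exact sub_nonneg.1 (hext _ ((hsq β).sub hcont)
      (fun n y hy => sub_nonneg.2 ((hv n).upper y hy)) x hx)

theorem IsBoundedSolution.isFeasible {v : NativeSpace hk}
    (hv : IsBoundedSolution f g h R α β Ω v.fn) (h0 : (0 : State N) ∈ Ω)
    {X : Finset (State N)} (hX : (X : Set (State N)) ⊆ Ω) : IsFeasible f g h R α β X v :=
  ⟨fun x hx => hv.hjb x (hX hx), fun x hx => hv.lower x (hX hx), fun x hx => hv.upper x (hX hx),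
    hv.apply_zero h0⟩

/-- Weak limits of feasible functions are feasible. -/
theorem NativeSpace.isFeasible_of_weak_limit (hd : IsControlData f g h R) (hΩ : IsOpen Ω)
    (h0 : (0 : State N) ∈ Ω)
    (hsm : ContDiffOn ℝ 2 (fun p : State N × State N => k p.1 p.2) (Ω ×ˢ Ω))
    {ι : Type*} {l : Filter ι} [l.NeBot] {v : ι → NativeSpace hk} {w : NativeSpace hk}
    (hweak : ∀ a, Tendsto (fun n => inner ℝ a (v n)) l (𝓝 (inner ℝ a w)))
    {X : Finset (State N)} (hX : (X : Set (State N)) ⊆ Ω)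
    (hv : ∀ᶠ n in l, IsFeasible f g h R α β X (v n)) : IsFeasible f g h R α β X w := by
  refine ⟨fun x hx => ?_, fun x hx => ?_, fun x hx => ?_, ?_⟩
  · have hlim : Tendsto (fun n => hjbResidual f g h R (v n).fn x) l
        (𝓝 (hjbResidual f g h R w.fn x)) := by
      have hpair : Tendsto (fun n => (x, gradient (v n).fn x)) l (𝓝 (x, gradient w.fn x)) :=
        tendsto_const_nhds.prodMk_nhds (tendsto_gradient_fn hΩ hsm hweak (hX hx))
      have := (hd.continuous_hamiltonian.tendsto (x, gradient w.fn x)).comp hpair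
      simpa only [Function.comp_def, ← hjbResidual_eq_hamiltonian] using this
    exact tendsto_nhds_unique hlim
      (tendsto_const_nhds.congr' (hv.mono fun n hn => (hn.hjb x hx).symm))
  · exact ge_of_tendsto (tendsto_fn hweak (hX hx)) (hv.mono fun n hn => hn.lower x hx)
  · exact le_of_tendsto (tendsto_fn hweak (hX hx)) (hv.mono fun n hn => hn.upper x hx)
  · exact tendsto_nhds_unique (tendsto_fn hweak h0)
      (tendsto_const_nhds.congr' (hv.mono fun n hn => hn.zero.symm))

theorem IsFeasible.mono {X Y : Finset (State N)} (hXY : X ⊆ Y) {v : NativeSpace hk}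
    (hv : IsFeasible f g h R α β Y v) : IsFeasible f g h R α β X v :=
  ⟨fun x hx => hv.hjb x (hXY hx), fun x hx => hv.lower x (hXY hx),
    fun x hx => hv.upper x (hXY hx), hv.zero⟩

/-- The optimal value function, when it lies in the native space, is a classical solution of the
HJB equation. -/
theorem NativeSpace.isBoundedSolution_valueFunction (hd : IsControlData f g h R) (hΩ : IsOpen Ω)
    (hsm : ContDiffOn ℝ 2 (fun p : State N × State N => k p.1 p.2) (Ω ×ˢ Ω))
    (hβ : 0 ≤ β)
    (hlower : ∀ x ∈ Ω, ENNReal.ofReal (α * ‖x‖ ^ 2) ≤ valueFunction f g h R x)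
    (hupper : ∀ x ∈ Ω, valueFunction f g h R x ≤ ENNReal.ofReal (β * ‖x‖ ^ 2))
    {v : NativeSpace hk} (hv : ∀ x ∈ Ω, v.fn x = (valueFunction f g h R x).toReal) :
    IsBoundedSolution f g h R α β Ω v.fn := by
  have hfin : ∀ x ∈ Ω, valueFunction f g h R x ≠ ∞ := fun x hx =>
    ne_top_of_le_ne_top ENNReal.ofReal_ne_top (hupper x hx)
  refine ⟨fun x hx => differentiableAt_fn hΩ hsm v hx, fun x hx => ?_, fun x hx => ?_,
    fun x hx => ?_⟩
  · have heq : v.fn =ᶠ[𝓝 x] fun z => (valueFunction f g h R z).toReal :=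
      eventually_of_mem (hΩ.mem_nhds hx) hv
    rw [heq.hjbResidual_eq]
    exact hd.hjbResidual_valueFunction (eventually_of_mem (hΩ.mem_nhds hx) hfin)
      ((differentiableAt_fn hΩ hsm v hx).congr_of_eventuallyEq heq.symm)
  · rw [hv x hx]
    exact (ENNReal.ofReal_le_iff_le_toReal (hfin x hx)).1 (hlower x hx)
  · rw [hv x hx]
    exact ENNReal.toReal_le_of_le_ofReal (by positivity) (hupper x hx)

end OptimalRecovery

theorem mainTheorem2 {N M : ℕ}
    (f : State N → State N) (g : State N → Matrix (Fin N) (Fin M) ℝ) (h : State N → ℝ)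
    (R : Matrix (Fin M) (Fin M) ℝ) (hdata : IsControlData f g h R)
    (Ω : Set (State N)) (hΩ_open : IsOpen Ω) (hΩ_conn : IsConnected Ω)
    (hΩ_bdd : Bornology.IsBounded Ω) (hΩ_zero : (0 : State N) ∈ Ω)
    -- two-sided quadratic bounds on the optimal value function
    (αs βs : ℝ) (hαs : 0 < αs) (hβs : 0 < βs)
    (hlower : ∀ x ∈ Ω, ENNReal.ofReal (αs * ‖x‖ ^ 2) ≤ valueFunction f g h R x)
    (hupper : ∀ x ∈ Ω, valueFunction f g h R x ≤ ENNReal.ofReal (βs * ‖x‖ ^ 2))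
    (α β : ℝ) (hα : 0 < α) (hααs : α ≤ αs) (hβsβ : βs ≤ β)
    -- nested finite sets of centers in `Ω \ {0}` whose union is dense in `Ω`
    (X : ℕ → Finset (State N)) (hX_sub : ∀ n, (X n : Set (State N)) ⊆ Ω \ {0})
    (hX_mono : Monotone X) (hX_dense : Ω ⊆ closure (⋃ n, (X n : Set (State N))))
    -- a positive definite kernel of class `C²` on `Ω × Ω`
    (k : State N → State N → ℝ) (hk : IsPDKernelOn k Ω)
    (hk_smooth : ContDiffOn ℝ 2 (fun p : State N × State N => k p.1 p.2) (Ω ×ˢ Ω))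
    -- the optimal value function belongs to `H_k(Ω)`
    (hmem : ∃ vs : NativeSpace hk, ∀ x ∈ Ω, vs.fn x = (valueFunction f g h R x).toReal) :
    ∃ (Ω' : Set (State N)) (hsub : Ω' ⊆ Ω),
      IsOpen Ω' ∧ IsConnected Ω' ∧ (0 : State N) ∈ Ω' ∧
      ∀ v : ℕ → NativeSpace hk, (∀ n, IsMinimizer f g h R α β (X n) (v n)) →
        -- the restrictions of `v n` and of the optimal value function to `Ω'` lie in `H_k(Ω')`
        ∃ (w : ℕ → NativeSpace (hk.mono hsub)) (ws : NativeSpace (hk.mono hsub)),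
          (∀ n, ∀ x ∈ Ω', (w n).fn x = (v n).fn x) ∧
          (∀ x ∈ Ω', ws.fn x = (valueFunction f g h R x).toReal) ∧
          Tendsto (fun n => ‖w n - ws‖) atTop (𝓝 0) := by
  obtain ⟨vs, hvs⟩ := hmem
  have hβ : 0 < β := hβs.trans_le hβsβ
  have hX_sub' : ∀ n, (X n : Set (State N)) ⊆ Ω := fun n => (hX_sub n).trans sdiff_subset
  have hsol : IsBoundedSolution f g h R α β Ω vs.fn := by
    refine NativeSpace.isBoundedSolution_valueFunction hdata hΩ_open hk_smooth hβ.le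
      (fun x hx => ?_) (fun x hx => ?_) hvs
    · exact le_trans (ENNReal.ofReal_le_ofReal (by gcongr)) (hlower x hx)
    · exact (hupper x hx).trans (ENNReal.ofReal_le_ofReal (by gcongr))
  obtain ⟨ρ, hρ, hsub, huniq⟩ := IsBoundedSolution.exists_forall_eq hdata hα hβ hΩ_open hΩ_zero
  obtain ⟨r, hr⟩ := NativeSpace.exists_restrict hk hsub
  refine ⟨Metric.ball 0 ρ, hsub, Metric.isOpen_ball,
    ⟨⟨0, Metric.mem_ball_self hρ⟩, (convex_ball _ _).isPreconnected⟩, Metric.mem_ball_self hρ,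
    fun v hv => ⟨fun n => r (v n), r vs, fun n => hr (v n), fun x hx => ?_, ?_⟩⟩
  · rw [hr vs x hx, hvs x (hsub hx)]
  -- Testing along ultrafilters allows the limit `w` on `Ω` to depend on the ultrafilter; only its
  -- restriction to the ball must not.
  rw [← tendsto_iff_norm_sub_tendsto_zero, tendsto_iff_ultrafilter]
  intro U hU
  obtain ⟨w, hw⟩ := exists_weak_limit_of_bounded U
    fun n => (hv n).2 vs (hsol.isFeasible hΩ_zero (hX_sub' n))
  have hfeas : ∀ m, IsFeasible f g h R α β (X m) w := fun m =>
    NativeSpace.isFeasible_of_weak_limit hdata hΩ_open hΩ_zero hk_smooth hw (hX_sub' m)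
      (hU ((eventually_ge_atTop m).mono fun n hn => (hv n).1.mono (hX_mono hn)))
  have hwsol : IsBoundedSolution f g h R α β Ω w.fn :=
    NativeSpace.isBoundedSolution_of_isFeasible hdata hΩ_open hk_smooth hX_sub' hX_dense hfeas
  -- Minimality is used a second time, now against `w` itself.
  have hlim : Tendsto v U (𝓝 w) :=
    tendsto_of_weak_limit_of_norm_le hw fun n => (hv n).2 w (hfeas n)
  have hrw : r w = r vs := NativeSpace.ext_fn fun x hx => by
    rw [hr w x hx, hr vs x hx, huniq _ _ hwsol hsol x hx]
  rw [← hrw]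
  exact (r.continuous.tendsto w).comp hlim
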